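/- For words $u$ and $v$ let $\binom{u}{v}$ be the number of occurrences of $v$ as a scattered factor of $u$, i.e. the number of index sequences $i_1<\dots<i_{|v|}$ with $u[i_1]\cdots u[i_{|v|}]=v$. Two words $w_1,w_2$ over a finite alphabet $\Sigma$ are $k$-binomial equivalent, $w_1\equiv_k w_2$, if $\binom{w_1}{v}=\binom{w_2}{v}$ for all words $v$ over $\Sigma$ of length at most $k$. The model of computation is the unit-cost RAM whose memory cells hold words of $W$ bits, with $W$ at least a constant times the logarithm of the input size ($W\ge c\log(n+|\Sigma|+2)$). Its instructions, each costing one unit of time, are arithmetic and bitwise operations, data movement with indirect addressing, conditional and unconditional jumps, and the generation of a uniformly random $W$-bit word. The input consists of $n$, $k$ and the letters of $w_1$ and $w_2$, encoded as integers in $\{0,\dots,|\Sigma|-1\}$, one per cell. **Theorem.** (a) There is a randomised algorithm (a fixed program of this machine) which, given $w_1,w_2\in\Sigma^*$ with $|w_1|=|w_2|=n$ and $k\le n$, always stops with an answer YES or NO after $O(nk^2+k^4)$ steps (for $k=0$: after $O(1)$ steps), whatever the random words are. If $w_1\equiv_k w_2$, it always answers YES; if $w_1\not\equiv_k w_2$,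 it answers NO with probability at least $1-\frac1n$. The program and the constants do not depend on $n$, $k$, $\Sigma$, $W$ or the words. (b) For binary words put $Q_{k,w}(x)=\sum_{1\le|v|\le k}\binom{w}{v}x^{\mathrm{bin}(1v)}\in\mathbb Z[x]$, where $v$ runs over the words over $\{0,1\}$ and $\mathrm{bin}(1v)$ is the number with binary representation $1v$. Let $w_1,w_2\in\{0,1\}^n$ and $k\le n$. Consider the test that draws $p$ uniformly from the primes with exactly $\lceil k+1+2\log_2 n\rceil$ binary digits, then draws $x$ uniformly from $\mathbb F_p$, and answers YES if $Q_{k,w_1}(x)=Q_{k,w_2}(x)$ in $\mathbb F_p$ and NO otherwise. If $w_1\equiv_k w_2$, this test always answers YES; if $w_1\not\equiv_k w_2$, it answers NO with probability at least $1-\frac1n$. -/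

import Mathlib

/-! ### Words, binomial coefficients of words, `k`-binomial equivalence

A word of length `n` over an alphabet with `σ` letters is a function `Fin n → Fin σ`. -/

namespace KBinomial

/-- The binomial coefficient of the words `u` and `v`: the number of occurrences of `v` as a
scattered factor of `u`, that is, of increasing sequences of positions of `u` that spell `v`. -/
def binom {σ n m : ℕ} (u : Fin n → Fin σ) (v : Fin m → Fin σ) : ℕ :=
  (Finset.univ.filter fun f : Fin m → Fin n =>
    (∀ i j, i < j → f i < f j) ∧ ∀ i, u (f i) = v i).card

/-- `w₁ ≡_k w₂`: every word of length at most `k` has the same number of scattered occurrences in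
`w₁` and in `w₂`. -/
def BinomEquiv {σ n : ℕ} (k : ℕ) (w₁ w₂ : Fin n → Fin σ) : Prop :=
  ∀ m ≤ k, ∀ v : Fin m → Fin σ, binom w₁ v = binom w₂ v

/-! ### The fingerprint test on binary words -/

/-- `bin(1v)`: the number whose binary representation is `1` followed by the word `v`. -/
def binOne {m : ℕ} (v : Fin m → Fin 2) : ℕ :=
  2 ^ m + ∑ i : Fin m, (v i : ℕ) * 2 ^ (m - 1 - (i : ℕ))

/-- `Q_{k,w} = ∑ (w choose v) x^{bin(1v)}` over the non-empty binary words `v` of length at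
most `k`, as a polynomial with integer coefficients. -/
noncomputable def Q {n : ℕ} (k : ℕ) (w : Fin n → Fin 2) : Polynomial ℤ :=
  ∑ m ∈ Finset.Icc 1 k, ∑ v : Fin m → Fin 2,
    Polynomial.C (binom w v : ℤ) * Polynomial.X ^ binOne v

/-- The primes with exactly `t` binary digits. -/
def bitPrimes (t : ℕ) : Finset ℕ :=
  (Finset.Ico (2 ^ (t - 1)) (2 ^ t)).filter Nat.Prime

/-- The number of bits `⌈k + 1 + 2 log₂ n⌉` of the random prime. -/
noncomputable def primeBits (n k : ℕ) : ℕ :=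
  ⌈(k : ℝ) + 1 + 2 * Real.logb 2 n⌉₊

/-- The probability that `Q_{k,w₁}(x) ≠ Q_{k,w₂}(x)` in `𝔽_p`, where `p` is uniformly distributed
on the primes with `⌈k + 1 + 2 log₂ n⌉` bits and, given `p`, `x` is uniformly distributed
on `𝔽_p`. -/
noncomputable def fingerprintNoProb {n : ℕ} (k : ℕ) (w₁ w₂ : Fin n → Fin 2) : ℝ :=
  (∑ p ∈ bitPrimes (primeBits n k),
      (Set.ncard {x : ZMod p | Polynomial.aeval x (Q k w₁) ≠ Polynomial.aeval x (Q k w₂)} : ℝ) / p)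
    / (bitPrimes (primeBits n k)).card

end KBinomial

/-! ### The randomised unit-cost RAM with words of `W` bits

There are registers and a memory with indirect addressing. Every register and memory cell holds a
word, represented by a natural number smaller than `2 ^ W`. Each instruction takes one unit
of time. -/

namespace WordRAM

/-- Arithmetic and bitwise operations. -/
inductive BinOp
  | add | sub | mul | div | rem | and | or | xor | shl | shr

/-- The value of an operation, as a `W`-bit word. Subtraction is cut off at zero. -/
def BinOp.eval (W : ℕ) (o : BinOp) (a b : ℕ) : ℕ :=
  (match o with
    | .add => a + b
    | .sub => a - b
    | .mul => a * b
    | .div => a / b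
    | .rem => a % b
    | .and => a &&& b
    | .or => a ||| b
    | .xor => a ^^^ b
    | .shl => a <<< b
    | .shr => a >>> b) % 2 ^ W

/-- Instructions; `d`, `a`, `b` are names of registers and `l` is a position in the program. -/
inductive Instr
  /-- `R[d] := c` for a constant `c` -/
  | const (d c : ℕ)
  /-- `R[d] := R[a]` -/
  | copy (d a : ℕ)
  /-- `R[d] := o (R[a], R[b])` -/
  | op (o : BinOp) (d a b : ℕ)
  /-- `R[d] :=` a fresh uniformly distributed random word -/
  | rand (d : ℕ)
  /-- `R[d] := M[R[a]]` -/
  | load (d a : ℕ)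
  /-- `M[R[a]] := R[b]` -/
  | store (a b : ℕ)
  /-- go to `l` -/
  | jump (l : ℕ)
  /-- if `R[a] = R[b]` go to `l` -/
  | jumpEq (a b l : ℕ)
  /-- if `R[a] < R[b]` go to `l` -/
  | jumpLt (a b l : ℕ)
  /-- stop and return an answer -/
  | halt (answer : Bool)

/-- A program is a finite list of instructions. -/
abbrev Program := List Instr

/-- A configuration of the machine. -/
structure Config where
  /-- the position of the next instruction -/
  pc : ℕ
  /-- the registers -/
  reg : ℕ → ℕ
  /-- the memory -/
  mem : ℕ → ℕ
  /-- how many random words have been read -/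
  used : ℕ
  /-- the answer, once the machine has stopped -/
  answer : Option Bool

/-- The effect of one instruction. The sequence `ω` holds the random words. -/
def Instr.exec {W : ℕ} (ω : ℕ → Fin (2 ^ W)) (s : Config) : Instr → Config
  | .const d c => { s with pc := s.pc + 1, reg := Function.update s.reg d (c % 2 ^ W) }
  | .copy d a => { s with pc := s.pc + 1, reg := Function.update s.reg d (s.reg a) }
  | .op o d a b =>
      { s with pc := s.pc + 1, reg := Function.update s.reg d (o.eval W (s.reg a) (s.reg b)) }
  | .rand d =>
      { s with
        pc := s.pc + 1, reg := Function.update s.reg d (ω s.used : ℕ), used := s.used + 1 }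
  | .load d a => { s with pc := s.pc + 1, reg := Function.update s.reg d (s.mem (s.reg a)) }
  | .store a b => { s with pc := s.pc + 1, mem := Function.update s.mem (s.reg a) (s.reg b) }
  | .jump l => { s with pc := l }
  | .jumpEq a b l => { s with pc := if s.reg a = s.reg b then l else s.pc + 1 }
  | .jumpLt a b l => { s with pc := if s.reg a < s.reg b then l else s.pc + 1 }
  | .halt r => { s with answer := some r }

/-- One step of the machine. A stopped machine stays as it is; a machine that has left its program
without a `halt` is stuck and never gives an answer. -/
def step (P : Program) {W : ℕ} (ω : ℕ → Fin (2 ^ W)) (s : Config) : Config :=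
  match s.answer with
  | some _ => s
  | none =>
    match P[s.pc]? with
    | none => s
    | some i => i.exec ω s

/-- The answer given by the machine within `T` steps from the configuration `s`, if any. -/
def answerWithin (P : Program) {W : ℕ} (ω : ℕ → Fin (2 ^ W)) (s : Config) (T : ℕ) : Option Bool :=
  ((step P ω)^[T] s).answer

/-- The sequence of random words that starts with `u`. A run of `T` steps reads no more than the
first `T` random words. -/
def extend {W T : ℕ} (u : Fin T → Fin (2 ^ W)) (i : ℕ) : Fin (2 ^ W) :=
  if h : i < T then u ⟨i, h⟩ else ⟨0, Nat.two_pow_pos W⟩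

/-- The probability that the machine gives the answer `r` within `T` steps from `s`, for independent
uniformly distributed random words of `W` bits. -/
noncomputable def probAnswer (P : Program) (W : ℕ) (s : Config) (T : ℕ) (r : Bool) : ℝ :=
  ((Finset.univ.filter fun u : Fin T → Fin (2 ^ W) =>
      answerWithin P (extend u) s T = some r).card : ℝ) /
    (Fintype.card (Fin T → Fin (2 ^ W)) : ℝ)

/-- The initial configuration for two words of length `n` and a number `k`: the registers `0` and
`1` hold `n` and `k`, the memory holds the letters of `w₁` and then those of `w₂`, one per
cell, and everything else is zero. -/
def start {σ n : ℕ} (k : ℕ) (w₁ w₂ : Fin n → Fin σ) : Config where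
  pc := 0
  reg := fun r => if r = 0 then n else if r = 1 then k else 0
  mem := fun i =>
    if h : i < n then (w₁ ⟨i, h⟩ : ℕ)
    else if h : i - n < n then (w₂ ⟨i - n, h⟩ : ℕ)
    else 0
  used := 0
  answer := none

end WordRAM

/-! Part (a) rests on a random linear combination. Give each letter a at each place j a weight
x(a,j), and let c_j(w) be the sum of the products of the weights over all scattered factors of w of
length j. By `weightedCount_eq_sum_binom`, c_j(w) is the sum of binom(w,v) ∏ x(v_i,i) over the words
v of length j. Different v give different monomials, so equivalent words always have equal sums. If
binom(w₁,v) ≠ binom(w₂,v) with |v| = m, then c_m(w₁) - c_m(w₂) is a nonzero polynomial of degree at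
most m in the weights: the indicator weights of v isolate the coefficient of v. By Schwartz–Zippel,
weights uniform below X = 4^s > n² make it vanish with probability at most m/X ≤ 1/n
(`card_weightedCount_eq_le`).

The sums obey the recursion c_{j+1}(wa) = c_{j+1}(w) + x(a,j) c_j(w). They stay below D^k with D =
8^s, so they are kept exactly, without a prime modulus, as k digits of one machine word each. A
letter costs k additions of a multiple, each O(k) steps, which gives O(nk²) in all. Weights are
drawn only for letters that occur, so the time does not depend on the alphabet. Correctness of the
machine is proved by loop invariants, combined in `reach_answer`.

In part (b) the exponents bin(1v) are distinct, so inequivalence gives a nonzero coefficient d of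
the difference of the two polynomials, with |d| ≤ (n choose m). The primes used are at least 2^s ≥
2^k n². If p does not divide d, the difference has fewer than 2^(k+1) roots mod p, a fraction of at
most 2/n². The primes dividing d form a fraction of at most 1/n - 2/n²
(`card_primeDivisors_mul_le`): d is too small to have many such divisors, while Erdős's analysis of
the central binomial coefficient gives at least 2^s/(4(s+1)) primes with s+1 digits. -/

namespace KBinomial

/-! ### Weighted counts of scattered factors -/

/-- The weighted number of scattered factors of length `j` of the first `i` letters of `w`: the
occurrence at positions `i₀ < i₁ < ⋯` has weight `x (w i₀) 0 * x (w i₁) 1 * ⋯`. -/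
def weightedCount {R : Type*} [CommSemiring R] (x : ℕ → ℕ → R) (w : ℕ → ℕ) : ℕ → ℕ → R
  | _, 0 => 1
  | 0, _ + 1 => 0
  | i + 1, j + 1 => weightedCount x w i (j + 1) + x (w i) j * weightedCount x w i j

@[simp]
theorem weightedCount_zero_right {R : Type*} [CommSemiring R] (x : ℕ → ℕ → R) (w : ℕ → ℕ) (i : ℕ) :
    weightedCount x w i 0 = 1 := by
  cases i <;> rfl

theorem weightedCount_congr {R : Type*} [CommSemiring R] {x y : ℕ → ℕ → R} {w w' : ℕ → ℕ}
    {i j : ℕ} (hw : ∀ a < i, w a = w' a) (hx : ∀ a < i, ∀ b < j, x (w a) b = y (w a) b) :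
    weightedCount x w i j = weightedCount y w' i j := by
  induction i generalizing j with
  | zero => cases j <;> rfl
  | succ i ih =>
    cases j with
    | zero => rfl
    | succ j =>
      simp only [weightedCount]
      rw [ih (fun a ha => hw a (by lia)) (fun a ha => hx a (by lia)),
        ih (fun a ha => hw a (by lia)) (fun a ha b hb => hx a (by lia) b (by lia)),
        hx i (by lia) j (by lia), hw i (by lia)]

theorem map_weightedCount {R S : Type*} [CommSemiring R] [CommSemiring S] (φ : R →+* S)
    (x : ℕ → ℕ → R) (w : ℕ → ℕ) (i j : ℕ) :
    φ (weightedCount x w i j) = weightedCount (fun a b => φ (x a b)) w i j := by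
  induction i generalizing j with
  | zero => cases j <;> simp [weightedCount]
  | succ i ih =>
    cases j with
    | zero => simp
    | succ j => simp [weightedCount, ih]

/-- There are (i choose j) position sequences, each of weight at most X^j. With X = 1 this bounds
the binomial coefficients of words; with X the range of the weights it shows that k digits suffice.
-/
theorem weightedCount_le {x : ℕ → ℕ → ℕ} {w : ℕ → ℕ} {X i j : ℕ}
    (hx : ∀ a < i, ∀ b < j, x (w a) b ≤ X) :
    weightedCount x w i j ≤ i.choose j * X ^ j := by
  induction i generalizing j with
  | zero => cases j <;> simp [weightedCount]
  | succ i ih =>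
    cases j with
    | zero => simp
    | succ j =>
      have h1 := ih (j := j + 1) (fun a ha => hx a (by lia))
      have h2 := ih (j := j) (fun a ha b hb => hx a (by lia) b (by lia))
      have h3 := Nat.mul_le_mul (hx i (by lia) j (by lia)) h2
      rw [weightedCount, Nat.choose_succ_succ]
      calc _ ≤ i.choose (j + 1) * X ^ (j + 1) + X * (i.choose j * X ^ j) := by lia
        _ = _ := by ring

open Finset in
/-- `weightedCount` is the sum of the weights of the increasing sequences of positions. -/
theorem weightedCount_eq_sum {R : Type*} [CommSemiring R] (x : ℕ → ℕ → R) {σ n : ℕ}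
    (u : Fin n → Fin σ) (w : ℕ → ℕ) (hw : ∀ a : Fin n, w a = u a) {i : ℕ} (hi : i ≤ n) (m : ℕ) :
    weightedCount x w i m =
      ∑ f : Fin m → Fin n with (∀ a b, a < b → f a < f b) ∧ ∀ a, (f a : ℕ) < i,
        ∏ a, x (u (f a)) a := by
  induction i generalizing m with
  | zero =>
    cases m with
    | zero => simp
    | succ m => simp [weightedCount]
  | succ i ih =>
    cases m with
    | zero => simp
    | succ m =>
      have hin : i < n := hi
      rw [weightedCount, ih hin.le, ih hin.le]
      -- The two terms of the recursion correspond to the last chosen position being before i or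
      -- equal to i; in the second case it is removed by `Fin.init`.
      rw [← sum_filter_add_sum_filter_not (univ.filter fun f : Fin (m + 1) → Fin n =>
        (∀ a b, a < b → f a < f b) ∧ ∀ a, (f a : ℕ) < i + 1) (fun f => (f (Fin.last m) : ℕ) < i)]
      congr 1
      · refine sum_congr ?_ fun _ _ => rfl
        ext f
        simp only [mem_filter, mem_univ, true_and]
        constructor
        · exact fun h => ⟨⟨h.1, fun a => (h.2 a).trans (Nat.lt_succ_self i)⟩, h.2 _⟩
        · refine fun h => ⟨h.1.1, fun a => ?_⟩
          rcases (Fin.le_last a).lt_or_eq with h' | rfl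
          · exact (Fin.lt_def.1 (h.1.1 _ _ h')).trans h.2
          · exact h.2
      · rw [mul_sum]
        refine sum_bij' (fun f _ => Fin.snoc (α := fun _ => Fin n) f ⟨i, hin⟩)
          (fun f _ => Fin.init (α := fun _ => Fin n) f) ?_ ?_ ?_ ?_ ?_
        · intro f hf
          simp only [mem_filter, mem_univ, true_and] at hf ⊢
          refine ⟨⟨fun a b => ?_, fun a => ?_⟩, by simp⟩
          · refine Fin.lastCases ?_ (fun b => ?_) b
            · refine Fin.lastCases (by simp) (fun a _ => ?_) a
              simpa [Fin.lt_def] using hf.2 a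
            · refine Fin.lastCases (fun h => ?_) (fun a h => ?_) a
              · exact absurd h (by simp [Fin.le_last])
              · simpa using hf.1 a b (by simpa using h)
          · refine Fin.lastCases (by simp) (fun a => ?_) a
            simpa using (hf.2 a).trans (Nat.lt_succ_self i)
        · intro f hf
          simp only [mem_filter, mem_univ, true_and] at hf ⊢
          have hl : (f (Fin.last m) : ℕ) = i := by have := hf.1.2 (Fin.last m); lia
          refine ⟨fun a b h => hf.1.1 _ _ (by simpa using h), fun a => ?_⟩
          rw [← hl]
          exact hf.1.1 a.castSucc (Fin.last m) (Fin.castSucc_lt_last a)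
        · intro f hf; simp
        · intro f hf
          simp only [mem_filter, mem_univ, true_and] at hf
          have hl : f (Fin.last m) = ⟨i, hin⟩ := by
            have := hf.1.2 (Fin.last m); ext; simp; lia
          rw [← hl, Fin.snoc_init_self]
        · intro f hf
          rw [Fin.prod_univ_castSucc]
          simp [mul_comm, ← hw]

/-- The weight of an occurrence depends only on the word it spells, so the position sequences are
grouped by that word. -/
theorem weightedCount_eq_sum_binom {R : Type*} [CommSemiring R] (x : ℕ → ℕ → R) {σ n : ℕ}
    (u : Fin n → Fin σ) (w : ℕ → ℕ) (hw : ∀ a : Fin n, w a = u a) (m : ℕ) :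
    weightedCount x w n m = ∑ v : Fin m → Fin σ, (binom u v : R) * ∏ a, x (v a) a := by
  rw [weightedCount_eq_sum x u w hw le_rfl, ← Finset.sum_fiberwise (g := fun f a => u (f a))]
  refine Finset.sum_congr rfl fun v _ => ?_
  rw [binom, ← nsmul_eq_mul, ← Finset.sum_const]
  refine Finset.sum_congr ?_ ?_
  · ext f
    simp [funext_iff]
  · intro f hf
    simp only [Finset.mem_filter, Finset.mem_univ, true_and] at hf
    simp [hf.2]

/-- The number of occurrences of `v` is the weighted count for the indicator weights of `v`. -/
theorem weightedCount_indicator {R : Type*} [CommSemiring R] {σ n m : ℕ}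
    (u : Fin n → Fin σ) (w : ℕ → ℕ) (hw : ∀ a : Fin n, w a = u a) (v : Fin m → Fin σ) :
    weightedCount (fun a j => if ∃ h : j < m, (v ⟨j, h⟩ : ℕ) = a then (1 : R) else 0) w n m =
      binom u v := by
  rw [weightedCount_eq_sum_binom _ u w hw, Finset.sum_eq_single v]
  · simp
  · intro v' _ hv
    obtain ⟨a, ha⟩ := Function.ne_iff.1 hv
    rw [Finset.prod_eq_zero (Finset.mem_univ a), mul_zero]
    rw [if_neg]
    rintro ⟨_, h⟩
    exact ha (Fin.ext h.symm)
  · simp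

theorem binom_le_choose {σ n m : ℕ} (u : Fin n → Fin σ) (v : Fin m → Fin σ) :
    binom u v ≤ n.choose m := by
  let w : ℕ → ℕ := fun a => if h : a < n then u ⟨a, h⟩ else 0
  have hw : ∀ a : Fin n, w a = u a := fun a => by simp [w]
  have h := weightedCount_indicator (R := ℕ) u w hw v
  rw [Nat.cast_id] at h
  rw [← h]
  refine (weightedCount_le (X := 1) fun a _ b _ => ?_).trans (by simp)
  split_ifs <;> simp

theorem binomEquiv_zero {σ n : ℕ} (w₁ w₂ : Fin n → Fin σ) : BinomEquiv 0 w₁ w₂ := by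
  intro m hm v
  obtain rfl : m = 0 := by lia
  simp [binom]

end KBinomial

namespace KBinomial

/-! ### Primes with a given number of binary digits -/

-- Erdős's proof of Bertrand's postulate with the primes in (N, 2N] kept as a separate factor. Every
-- prime power in the central binomial coefficient is at most 2N; primes above √(2N) occur at most
-- once, and those in (2N/3, N] do not occur at all, so the middle factor is bounded by a primorial.
open Nat in
theorem centralBinom_le_mul_pow_card_primes (N : ℕ) (hN : 2 < N) :
    centralBinom N ≤ (2 * N) ^ sqrt (2 * N) * 4 ^ (2 * N / 3) *
      (2 * N) ^ ((Finset.Ioc N (2 * N)).filter Nat.Prime).card := by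
  have N2_pos : 1 ≤ 2 * N := by lia
  let f x := x ^ N.centralBinom.factorization x
  let S := {p ∈ Finset.range (2 * N + 1) | Nat.Prime p}
  have hS : centralBinom N = ∏ x ∈ S, f x := by
    refine N.prod_pow_factorization_centralBinom.symm.trans (Eq.symm ?_)
    refine Finset.prod_filter_of_ne fun p _ h => ?_
    contrapose h
    dsimp only [f]
    rw [factorization_eq_zero_of_not_prime N.centralBinom h, _root_.pow_zero]
  have hf : ∀ p, f p ≤ 2 * N := fun p => pow_factorization_choose_le (by lia)
  rw [hS, ← Finset.prod_filter_not_mul_prod_filter S (N < ·)]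
  refine Nat.mul_le_mul ?_ ?_
  · rw [← Finset.prod_filter_mul_prod_filter_not _ (· ≤ sqrt (2 * N))]
    refine Nat.mul_le_mul ?_ ?_
    · refine (Finset.prod_le_prod' fun p _ => hf p).trans ?_
      rw [Finset.prod_const]
      have : (Finset.Icc 1 (sqrt (2 * N))).card = sqrt (2 * N) := by
        rw [card_Icc, Nat.add_sub_cancel]
      refine pow_right_mono₀ N2_pos ((Finset.card_le_card fun x hx => ?_).trans this.le)
      simp only [Finset.mem_filter, S] at hx
      exact Finset.mem_Icc.mpr ⟨hx.1.1.2.one_lt.le, hx.2⟩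
    · refine le_trans ?_ (primorial_le_four_pow (2 * N / 3))
      rw [← Finset.prod_filter_of_ne (p := fun p => p ≤ 2 * N / 3)]
      · refine (Finset.prod_le_prod' fun p hp => (?_ : f p ≤ p)).trans ?_
        · simp only [Finset.mem_filter, S] at hp
          refine (pow_right_mono₀ hp.1.1.1.2.one_lt.le ?_).trans (pow_one p).le
          exact Nat.factorization_choose_le_one (sqrt_lt'.mp <| not_le.1 hp.1.2)
        · refine Finset.prod_le_prod_of_subset_of_one_le' (fun p hp => ?_) ?_
          · simp only [Finset.mem_filter, S] at hp
            exact mem_primesLE.2 ⟨hp.2, hp.1.1.1.2⟩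
          · exact fun p hp _ => (prime_of_mem_primesLE hp).one_lt.le
      · intro p hp hne
        contrapose! hne
        simp only [Finset.mem_filter, S] at hp
        dsimp only [f]
        rw [factorization_centralBinom_of_two_mul_self_lt_three_mul hN (by lia) (by lia),
          Nat.pow_zero]
  · refine (Finset.prod_le_prod' fun p _ => hf p).trans ?_
    rw [Finset.prod_const]
    refine pow_right_mono₀ N2_pos (Finset.card_le_card fun x hx => ?_)
    simp only [Finset.mem_filter, S, Finset.mem_range] at hx
    simp only [Finset.mem_filter, Finset.mem_Ioc]
    exact ⟨⟨hx.2, by lia⟩, hx.1.2⟩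

/-- The two intervals differ only in their end points, which are powers of two with exponent at
least 2 and hence not prime. -/
theorem bitPrimes_eq_filter_Ioc {s : ℕ} (hs : 2 ≤ s) :
    bitPrimes (s + 1) = (Finset.Ioc (2 ^ s) (2 * 2 ^ s)).filter Nat.Prime := by
  ext p
  simp only [bitPrimes, Finset.mem_filter, Finset.mem_Ico, Finset.mem_Ioc, add_tsub_cancel_right]
  have h1 : ¬ Nat.Prime (2 ^ s) := Nat.Prime.not_prime_pow hs
  have h2 : ¬ Nat.Prime (2 ^ (s + 1)) := Nat.Prime.not_prime_pow (by lia)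
  have h3 : 2 * 2 ^ s = 2 ^ (s + 1) := by ring
  rw [h3]
  constructor
  · rintro ⟨⟨h, h'⟩, hp⟩
    exact ⟨⟨lt_of_le_of_ne h (by rintro rfl; exact h1 hp), h'.le⟩, hp⟩
  · rintro ⟨⟨h, h'⟩, hp⟩
    exact ⟨⟨h.le, lt_of_le_of_ne h' (by rintro rfl; exact h2 hp)⟩, hp⟩

theorem card_bitPrimes_pos {s : ℕ} (hs : 2 ≤ s) : 0 < (bitPrimes (s + 1)).card := by
  obtain ⟨p, hp, h1, h2⟩ := Nat.exists_prime_lt_and_le_two_mul (2 ^ s) (by positivity)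
  rw [bitPrimes_eq_filter_Ioc hs]
  exact Finset.card_pos.2 ⟨p, by simp [hp, h1, h2]⟩

theorem sq_succ_mul_le_two_pow {s : ℕ} (hs : 11 ≤ s) : 25 * (s + 1) ^ 2 ≤ 2 * 2 ^ s := by
  induction s, hs using Nat.le_induction with
  | base => norm_num
  | succ s hs ih => rw [pow_succ 2 s]; nlinarith

/-- A Chebyshev-type lower bound, from comparing 4^N < N (2N choose N) with the factorisation bound
at N = 2^s. The threshold 11 is where 25(s+1)² ≤ 2N starts to hold. -/
theorem two_pow_le_card_bitPrimes {s : ℕ} (hs : 11 ≤ s) :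
    2 ^ s ≤ 4 * (s + 1) * (bitPrimes (s + 1)).card := by
  have h1 := sq_succ_mul_le_two_pow hs
  rw [bitPrimes_eq_filter_Ioc (by lia)]
  set c := ((Finset.Ioc (2 ^ s) (2 * 2 ^ s)).filter Nat.Prime).card with hc
  have hN : 2 ^ 11 ≤ 2 ^ s := Nat.pow_le_pow_right (by norm_num) hs
  have h2 := Nat.four_pow_lt_mul_centralBinom (2 ^ s) (by lia)
  have h3 := centralBinom_le_mul_pow_card_primes (2 ^ s) (by lia)
  rw [← hc] at h3
  have h4 : 2 ^ (2 * 2 ^ s) <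
      2 ^ (s + (s + 1) * Nat.sqrt (2 * 2 ^ s) + 2 * (2 * 2 ^ s / 3) + (s + 1) * c) := by
    calc 2 ^ (2 * 2 ^ s) = 4 ^ 2 ^ s := by rw [pow_mul]; norm_num
      _ < _ := h2
      _ ≤ _ := Nat.mul_le_mul_left _ h3
      _ = _ := by
        rw [show (4 : ℕ) = 2 ^ 2 by norm_num, show 2 * 2 ^ s = 2 ^ (s + 1) by ring, ← pow_mul,
          ← pow_mul, ← pow_mul, ← pow_add, ← pow_add, ← pow_add]
        ring_nf
  have h5 := (Nat.pow_lt_pow_iff_right (by norm_num)).1 h4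
  have h6 : 2 * (2 * 2 ^ s / 3) * 3 ≤ 4 * 2 ^ s := by lia
  have h7 : 5 * ((s + 1) * Nat.sqrt (2 * 2 ^ s)) ≤ 2 * 2 ^ s := by
    have hr : Nat.sqrt (2 * 2 ^ s) ^ 2 ≤ 2 * 2 ^ s := Nat.sqrt_le' _
    refine (Nat.pow_le_pow_iff_left (n := 2) (by norm_num)).1 ?_
    calc _ = 25 * (s + 1) ^ 2 * Nat.sqrt (2 * 2 ^ s) ^ 2 := by ring
      _ ≤ (2 * 2 ^ s) * (2 * 2 ^ s) := Nat.mul_le_mul h1 hr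
      _ = _ := by ring
  have h8 : 60 * s ≤ 2 ^ s := by nlinarith
  -- The exponents leave (s+1)c > 2N - 4N/3 - 2N/5 - N/60 = N/4.
  rw [mul_assoc]
  lia

/-- The few prime divisors of a small number are a small fraction of the primes with a given
number of binary digits. -/
theorem card_primeDivisors_mul_le {n k m s d : ℕ} (hn : 2 ≤ n) (hmk : m ≤ k)
    (hs : 2 ^ k * n ^ 2 ≤ 2 ^ s) (hd : d ≠ 0) (hdle : d ≤ n.choose m) :
    ((bitPrimes (s + 1)).filter (· ∣ d)).card * n ^ 2 ≤ (bitPrimes (s + 1)).card * (n - 2) := by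
  set b := ((bitPrimes (s + 1)).filter (· ∣ d)).card with hb
  rcases Nat.eq_zero_or_pos b with h0 | hpos
  · simp [h0]
  have hprod : (2 ^ s) ^ b ≤ d := by
    calc (2 ^ s) ^ b = ∏ p ∈ (bitPrimes (s + 1)).filter (· ∣ d), 2 ^ s := by
          rw [Finset.prod_const]
      _ ≤ ∏ p ∈ (bitPrimes (s + 1)).filter (· ∣ d), p := by
          refine Finset.prod_le_prod' fun p hp => ?_
          simp only [bitPrimes, Finset.mem_filter, Finset.mem_Ico, add_tsub_cancel_right] at hp
          exact hp.1.1.1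
      _ ≤ d := by
          refine Nat.le_of_dvd (Nat.pos_of_ne_zero hd) ?_
          refine Finset.prod_primes_dvd d (fun p hp => ?_) fun p hp => (Finset.mem_filter.1 hp).2
          simp only [bitPrimes, Finset.mem_filter] at hp
          exact hp.1.2.prime
  -- A single prime divisor already forces d ≥ 2^s. This excludes small m and n, where the analytic
  -- estimates below would fail.
  have hN : 2 ^ m * n ^ 2 ≤ n.choose m := by
    calc 2 ^ m * n ^ 2 ≤ 2 ^ k * n ^ 2 :=
          Nat.mul_le_mul_right _ (Nat.pow_le_pow_right (by norm_num) hmk)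
      _ ≤ 2 ^ s := hs
      _ ≤ (2 ^ s) ^ b := Nat.le_self_pow hpos.ne' _
      _ ≤ _ := hprod.trans hdle
  have hn2 : 0 < n ^ 2 := by positivity
  have hm3 : 3 ≤ m := by
    by_contra h
    interval_cases m
    · simp at hN; nlinarith
    · simp at hN; nlinarith
    · have := Nat.choose_le_pow n 2
      nlinarith
  have hmn : m ≤ n := by
    by_contra h
    rw [Nat.choose_eq_zero_of_lt (by lia)] at hN
    have : 0 < 2 ^ m * n ^ 2 := by positivity
    lia
  have hn16 : 16 ≤ n := by
    by_contra h
    have key : ∀ n < 16, ∀ m < 16, n ≠ 0 → 3 ≤ m → n.choose m < 2 ^ m * n ^ 2 := by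
      decide
    exact absurd hN (not_le.2 (key n (by lia) m (by lia) (by lia) hm3))
  have hs11 : 11 ≤ s := by
    refine (Nat.pow_le_pow_iff_right (a := 2) (by norm_num)).1 (le_trans ?_ hs)
    calc 2 ^ 11 = 2 ^ 3 * 16 ^ 2 := by norm_num
      _ ≤ 2 ^ k * n ^ 2 := Nat.mul_le_mul (Nat.pow_le_pow_right (by norm_num) (by lia))
          (Nat.pow_le_pow_left hn16 _)
  -- Each of the b primes is at least n² and their product is at most n^m.
  have hbk : 2 * b ≤ k := by
    refine (Nat.pow_le_pow_iff_right (a := n) (by lia)).1 ?_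
    calc n ^ (2 * b) = (n ^ 2) ^ b := by rw [pow_mul]
      _ ≤ (2 ^ s) ^ b :=
          Nat.pow_le_pow_left (le_trans (Nat.le_mul_of_pos_left _ (by positivity)) hs) _
      _ ≤ n ^ m := (hprod.trans hdle).trans (Nat.choose_le_pow _ _)
      _ ≤ n ^ k := Nat.pow_le_pow_right (by lia) hmk
  have h1 := sq_succ_mul_le_two_pow hs11
  have h2 := two_pow_le_card_bitPrimes hs11
  set c := (bitPrimes (s + 1)).card
  have hb4 : 4 * b ^ 2 * n ^ 2 ≤ 2 ^ s := by
    refine le_trans (Nat.mul_le_mul_right _ ?_) hs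
    calc 4 * b ^ 2 = (2 * b) ^ 2 := by ring
      _ ≤ (2 ^ b) ^ 2 := Nat.pow_le_pow_left (by
          have := Nat.lt_two_pow_self (n := b - 1)
          obtain ⟨a, ha⟩ : ∃ a, b = a + 1 := ⟨b - 1, by lia⟩
          rw [ha] at this ⊢
          rw [pow_succ]; simp at this; lia) _
      _ = 2 ^ (2 * b) := by rw [← pow_mul, mul_comm]
      _ ≤ 2 ^ k := Nat.pow_le_pow_right (by norm_num) hbk
  obtain ⟨e, rfl⟩ : ∃ e, n = e + 2 := ⟨n - 2, by lia⟩
  rw [Nat.add_sub_cancel]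
  -- After squaring, this is the product of 25(s+1)² ≤ 2·2^s, 4b²n² ≤ 2^s and 8n² ≤ 25(n-2)².
  have h3 : 4 * (s + 1) * (b * (e + 2) ^ 2) ≤ 2 ^ s * e := by
    refine (Nat.pow_le_pow_iff_left (n := 2) (by norm_num)).1 ?_
    have h4 : 8 * (e + 2) ^ 2 ≤ 25 * e ^ 2 := by nlinarith
    have h5 : (25 * (s + 1) ^ 2) * (4 * b ^ 2 * (e + 2) ^ 2) ≤ (2 * 2 ^ s) * 2 ^ s :=
      Nat.mul_le_mul h1 hb4
    have h6 := Nat.mul_le_mul h5 h4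
    have h7 : 200 * (4 * (s + 1) * (b * (e + 2) ^ 2)) ^ 2 ≤ 200 * (2 ^ s * e) ^ 2 := by
      calc _ = 4 * (25 * (s + 1) ^ 2 * (4 * b ^ 2 * (e + 2) ^ 2) * (8 * (e + 2) ^ 2)) := by ring
        _ ≤ 4 * (2 * 2 ^ s * 2 ^ s * (25 * e ^ 2)) := Nat.mul_le_mul_left _ h6
        _ = _ := by ring
    lia
  have h4 : 4 * (s + 1) * (b * (e + 2) ^ 2) ≤ 4 * (s + 1) * (c * e) :=
    h3.trans (by rw [← mul_assoc]; exact Nat.mul_le_mul_right _ h2)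
  exact Nat.le_of_mul_le_mul_left h4 (by lia)

/-- A prime with s+1 binary digits is only known to be at least 2^s; the summand 1 in the number of
digits makes up for this. -/
theorem exists_primeBits_eq {n : ℕ} (hn : 1 ≤ n) (k : ℕ) :
    ∃ s, primeBits n k = s + 1 ∧ 2 ^ k * n ^ 2 ≤ 2 ^ s := by
  have h0 : 0 ≤ Real.logb 2 n := Real.logb_nonneg (by norm_num) (by exact_mod_cast hn)
  have h1 : (k : ℝ) + 1 + 2 * Real.logb 2 n ≤ primeBits n k := Nat.le_ceil _
  have h2 : 1 ≤ primeBits n k := by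
    have : (1 : ℝ) ≤ primeBits n k := by
      have : (0 : ℝ) ≤ k := Nat.cast_nonneg k
      linarith
    exact_mod_cast this
  obtain ⟨s, hs⟩ : ∃ s, primeBits n k = s + 1 := ⟨primeBits n k - 1, by lia⟩
  refine ⟨s, hs, ?_⟩
  rw [hs] at h1
  push_cast at h1
  have h3 : (2 : ℝ) ^ ((k : ℝ) + 2 * Real.logb 2 n) ≤ 2 ^ (s : ℝ) :=
    Real.rpow_le_rpow_of_exponent_le (by norm_num) (by linarith)
  rw [Real.rpow_add (by norm_num), mul_comm 2, Real.rpow_mul (by norm_num),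
    Real.rpow_logb (by norm_num) (by norm_num) (by exact_mod_cast hn), Real.rpow_natCast,
    Real.rpow_natCast, Real.rpow_ofNat] at h3
  exact_mod_cast h3

/-! ### The fingerprint polynomial -/

theorem binOne_succ {m : ℕ} (v : Fin (m + 1) → Fin 2) :
    binOne v = 2 * binOne (fun i => v i.castSucc) + v (Fin.last m) := by
  rw [binOne, binOne, Fin.sum_univ_castSucc, mul_add, Finset.mul_sum]
  have : ∀ i : Fin m, (v i.castSucc : ℕ) * 2 ^ (m + 1 - 1 - (i.castSucc : ℕ)) =
      2 * ((v i.castSucc : ℕ) * 2 ^ (m - 1 - (i : ℕ))) := by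
    intro i
    have h : m + 1 - 1 - (i.castSucc : ℕ) = (m - 1 - (i : ℕ)) + 1 := by
      have := i.2
      simp
      lia
    rw [h, pow_succ]
    ring
  rw [Finset.sum_congr rfl fun i _ => this i]
  simp [pow_succ]
  ring

theorem binOne_lt {m : ℕ} (v : Fin m → Fin 2) : binOne v < 2 ^ (m + 1) := by
  induction m with
  | zero => simp [binOne]
  | succ m ih =>
    rw [binOne_succ, pow_succ]
    have := ih fun i => v i.castSucc
    have := (v (Fin.last m)).2
    lia

theorem binOne_injective {m : ℕ} {v v' : Fin m → Fin 2} (h : binOne v = binOne v') : v = v' := by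
  induction m with
  | zero => exact Subsingleton.elim _ _
  | succ m ih =>
    rw [binOne_succ, binOne_succ] at h
    have h1 := (v (Fin.last m)).2
    have h2 := (v' (Fin.last m)).2
    have h3 := ih (v := fun i => v i.castSucc) (v' := fun i => v' i.castSucc) (by lia)
    funext i
    refine Fin.lastCases (Fin.ext (by lia)) (fun i => congrFun h3 i) i

/-- The leading 1 reveals the length, since bin(1v) lies in [2^m, 2^(m+1)). Together with
injectivity for fixed length, no two words share an exponent of the fingerprint polynomial. -/
theorem length_eq_of_binOne_eq {m m' : ℕ} {v : Fin m → Fin 2} {v' : Fin m' → Fin 2}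
    (h : binOne v = binOne v') : m = m' := by
  have h1 := binOne_lt v
  have h2 := binOne_lt v'
  have h3 : 2 ^ m ≤ binOne v := Nat.le_add_right _ _
  have h4 : 2 ^ m' ≤ binOne v' := Nat.le_add_right _ _
  have h5 := (Nat.pow_lt_pow_iff_right (a := 2) (by norm_num)).1 (h3.trans_lt (h ▸ h2))
  have h6 := (Nat.pow_lt_pow_iff_right (a := 2) (by norm_num)).1 (h4.trans_lt (h ▸ h1))
  lia

theorem coeff_Q {n k m : ℕ} (w : Fin n → Fin 2) (hm : m ∈ Finset.Icc 1 k) (v : Fin m → Fin 2) :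
    (Q k w).coeff (binOne v) = binom w v := by
  simp only [Q, Polynomial.finsetSum_coeff, Polynomial.coeff_C_mul_X_pow]
  rw [Finset.sum_eq_single_of_mem m hm, Finset.sum_eq_single v]
  · simp
  · intro v' _ hv
    rw [if_neg fun h => hv (binOne_injective h).symm]
  · simp
  · intro m' _ hm'
    refine Finset.sum_eq_zero fun v' _ => ?_
    rw [if_neg fun h => hm' (length_eq_of_binOne_eq h).symm]

theorem natDegree_Q_lt {n : ℕ} (k : ℕ) (w : Fin n → Fin 2) : (Q k w).natDegree < 2 ^ (k + 1) := by
  refine Nat.lt_of_le_pred (by positivity) ?_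
  refine Polynomial.natDegree_sum_le_of_forall_le _ _ fun m hm => ?_
  refine Polynomial.natDegree_sum_le_of_forall_le _ _ fun v _ => ?_
  refine (Polynomial.natDegree_C_mul_X_pow_le _ _).trans (Nat.le_pred_of_lt ?_)
  exact (binOne_lt v).trans_le
    (Nat.pow_le_pow_right (by norm_num) (by have := (Finset.mem_Icc.1 hm).2; lia))

theorem Q_eq_of_binomEquiv {n k : ℕ} {w₁ w₂ : Fin n → Fin 2} (h : BinomEquiv k w₁ w₂) :
    Q k w₁ = Q k w₂ := by
  refine Finset.sum_congr rfl fun m hm => Finset.sum_congr rfl fun v _ => ?_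
  rw [h m (Finset.mem_Icc.1 hm).2 v]

/-- Unless `p` divides the coefficients, two polynomials of degree less than `b` differ at all but
`b` points of `𝔽_p`. -/
theorem le_ncard_aeval_ne {f g : Polynomial ℤ} {p b e : ℕ} (hp : p.Prime) (hf : f.natDegree < b)
    (hg : g.natDegree < b) (hne : ¬ (p : ℤ) ∣ f.coeff e - g.coeff e) :
    p - b ≤ Set.ncard {x : ZMod p | Polynomial.aeval x f ≠ Polynomial.aeval x g} := by
  have := Fact.mk hp
  classical
  set h : Polynomial (ZMod p) := (f - g).map (Int.castRingHom (ZMod p)) with hh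
  have h0 : h ≠ 0 := by
    intro h0
    apply hne
    have := congrArg (fun q => Polynomial.coeff q e) h0
    simp only [hh, Polynomial.coeff_map, Polynomial.coeff_sub, Polynomial.coeff_zero,
      eq_intCast] at this
    exact (ZMod.intCast_zmod_eq_zero_iff_dvd _ _).1 (by exact_mod_cast this)
  have hdeg : h.natDegree < b :=
    (Polynomial.natDegree_map_le.trans (Polynomial.natDegree_sub_le f g)).trans_lt (max_lt hf hg)
  have hset : {x : ZMod p | Polynomial.aeval x f ≠ Polynomial.aeval x g} =
      ((Finset.univ \ h.roots.toFinset : Finset (ZMod p)) : Set (ZMod p)) := by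
    ext x
    simp only [Set.mem_ofPred_eq, Finset.coe_sdiff, Finset.coe_univ, Set.mem_sdiff, Set.mem_univ,
      Finset.mem_coe, Multiset.mem_toFinset, Polynomial.mem_roots h0, Polynomial.IsRoot, true_and]
    rw [hh, Polynomial.eval_map, ← algebraMap_int_eq, ← Polynomial.aeval_def, map_sub,
      sub_eq_zero]
  rw [hset, Set.ncard_coe_finset, Finset.card_sdiff_of_subset (Finset.subset_univ _),
    Finset.card_univ, ZMod.card]
  have := (Multiset.toFinset_card_le h.roots).trans h.card_roots'
  lia

theorem le_fingerprintNoProb {n k : ℕ} (w₁ w₂ : Fin n → Fin 2) (h : ¬ BinomEquiv k w₁ w₂) :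
    1 - 1 / (n : ℝ) ≤ fingerprintNoProb k w₁ w₂ := by
  have hnonneg : 0 ≤ fingerprintNoProb k w₁ w₂ :=
    div_nonneg (Finset.sum_nonneg fun p _ => by positivity) (by positivity)
  obtain ⟨m, hmk, v, hv⟩ : ∃ m ≤ k, ∃ v : Fin m → Fin 2, binom w₁ v ≠ binom w₂ v := by
    simpa [BinomEquiv] using h
  have hm1 : 1 ≤ m := by
    rcases Nat.eq_zero_or_pos m with rfl | h'
    · exact absurd (binomEquiv_zero w₁ w₂ 0 le_rfl v) hv
    · exact h'
  -- For n = 0 the bound reads 1, because 1/0 = 0, but then no words are inequivalent; for n = 1 it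
  -- reads 0.
  rcases lt_or_ge n 2 with hn | hn
  · rcases Nat.eq_zero_or_pos n with rfl | hn0
    · refine absurd ?_ hv
      obtain ⟨m, rfl⟩ : ∃ m', m = m' + 1 := ⟨m - 1, by lia⟩
      simp [binom]
    · obtain rfl : n = 1 := by lia
      simpa using hnonneg
  obtain ⟨s, hs, hsN⟩ := exists_primeBits_eq (by lia : 1 ≤ n) k
  have hs2 : 2 ≤ s := by
    refine (Nat.pow_le_pow_iff_right (a := 2) (by norm_num)).1 (le_trans ?_ hsN)
    have : 1 ≤ 2 ^ k := Nat.one_le_two_pow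
    nlinarith
  set d : ℕ := ((binom w₁ v : ℤ) - binom w₂ v).natAbs with hd
  have hd0 : d ≠ 0 := by
    rw [hd, Int.natAbs_ne_zero, sub_ne_zero]
    exact_mod_cast hv
  have hdle : d ≤ n.choose m := by
    have h1 := binom_le_choose w₁ v
    have h2 := binom_le_choose w₂ v
    lia
  have hbad := card_primeDivisors_mul_le hn hmk hsN hd0 hdle
  have hpos := card_bitPrimes_pos hs2
  set S := bitPrimes (s + 1) with hS
  set bad := (S.filter (· ∣ d)).card with hbaddef
  -- A bad prime is charged a full 1, making its left-hand side negative; a good one loses at most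
  -- 2^(k+1)/p ≤ 2/n² to roots. Averaging gives 1 - 2/n² - bad/|S|.
  have hterm : ∀ p ∈ S, (1 - 2 / (n : ℝ) ^ 2) - (if p ∣ d then 1 else 0) ≤
      (Set.ncard {x : ZMod p | Polynomial.aeval x (Q k w₁) ≠ Polynomial.aeval x (Q k w₂)} : ℝ)
        / p := by
    intro p hp
    simp only [hS, bitPrimes, Finset.mem_filter, Finset.mem_Ico, add_tsub_cancel_right] at hp
    have hn0 : (0 : ℝ) < n := by exact_mod_cast (by lia : 0 < n)
    split_ifs with hdvd
    · have h1 : 0 ≤ 2 / (n : ℝ) ^ 2 := by positivity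
      refine le_trans (by linarith) (div_nonneg (Nat.cast_nonneg _) (Nat.cast_nonneg _))
    · have h1 := le_ncard_aeval_ne (e := binOne v) hp.2 (natDegree_Q_lt k w₁) (natDegree_Q_lt k w₂)
        (by
          rw [coeff_Q _ (Finset.mem_Icc.2 ⟨hm1, hmk⟩), coeff_Q _ (Finset.mem_Icc.2 ⟨hm1, hmk⟩)]
          rwa [← Int.natCast_dvd] at hdvd)
      have hp0 : (0 : ℝ) < p := by exact_mod_cast hp.2.pos
      have h2 : 2 ^ k * n ^ 2 ≤ p := hsN.trans hp.1.1
      have h2' : (2 : ℝ) ^ k * n ^ 2 ≤ p := by exact_mod_cast h2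
      rw [le_div_iff₀ hp0, sub_zero]
      have h3 : (p : ℝ) - 2 ^ (k + 1) ≤
          (Set.ncard {x : ZMod p |
            Polynomial.aeval x (Q k w₁) ≠ Polynomial.aeval x (Q k w₂)} : ℝ) := by
        rw [sub_le_iff_le_add]
        exact_mod_cast (by lia)
      refine le_trans ?_ h3
      have h4 : (2 : ℝ) ^ (k + 1) ≤ 2 / (n : ℝ) ^ 2 * p := by
        rw [div_mul_eq_mul_div, le_div_iff₀ (by positivity), pow_succ]
        linarith
      linarith
  have hsum := Finset.sum_le_sum hterm
  rw [Finset.sum_sub_distrib, Finset.sum_const, nsmul_eq_mul, Finset.sum_boole] at hsum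
  rw [fingerprintNoProb, hs, ← hS]
  have hc : (0 : ℝ) < S.card := by exact_mod_cast hpos
  rw [le_div_iff₀ hc]
  refine le_trans ?_ hsum
  have hn0 : (0 : ℝ) < n := by exact_mod_cast (by lia : 0 < n)
  have hbad' : (bad : ℝ) * n ^ 2 ≤ S.card * (n - 2) := by
    have : ((n - 2 : ℕ) : ℝ) = n - 2 := by push_cast [hn]; ring
    rw [← this]
    exact_mod_cast hbad
  have h5 : (bad : ℝ) ≤ S.card * (1 / n - 2 / n ^ 2) := by
    have : S.card * (1 / n - 2 / n ^ 2) = (S.card * ((n : ℝ) - 2)) / n ^ 2 := by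
      field_simp
    rw [this, le_div_iff₀ (by positivity)]
    exact hbad'
  change _ ≤ _ - (bad : ℝ)
  nlinarith

end KBinomial

namespace WordRAM

/-! ### Reasoning about runs of the machine -/

/-- Within `T` steps from `s`, the machine passes through a configuration satisfying `A`. -/
def Reach (P : Program) {W : ℕ} (ω : ℕ → Fin (2 ^ W)) (T : ℕ) (A : Config → Prop) (s : Config) :
    Prop :=
  ∃ t ≤ T, A ((step P ω)^[t] s)

/-- The machine is running, at position `pc` and after `u` random words, and its registers and
its memory satisfy `R`. -/
def At (pc u : ℕ) (R : (ℕ → ℕ) → (ℕ → ℕ) → Prop) (s : Config) : Prop :=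
  ∃ reg mem, s = ⟨pc, reg, mem, u, none⟩ ∧ R reg mem

section Reach

variable {P : Program} {W : ℕ} {ω : ℕ → Fin (2 ^ W)} {T T' : ℕ} {A B : Config → Prop} {s : Config}

theorem Reach.refl (h : A s) : Reach P ω T A s := ⟨0, Nat.zero_le _, h⟩

theorem Reach.mono (h : Reach P ω T A s) (hT : T ≤ T') : Reach P ω T' A s :=
  h.imp fun _ ht => ⟨ht.1.trans hT, ht.2⟩

theorem Reach.imp (h : Reach P ω T A s) (hA : ∀ s, A s → B s) : Reach P ω T B s :=
  Exists.imp (fun _ ht => ⟨ht.1, hA _ ht.2⟩) h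

theorem Reach.trans (h : Reach P ω T A s) (h' : ∀ s, A s → Reach P ω T' B s) :
    Reach P ω (T + T') B s := by
  obtain ⟨t, ht, hA⟩ := h
  obtain ⟨t', ht', hB⟩ := h' _ hA
  exact ⟨t' + t, by lia, by rwa [Function.iterate_add_apply]⟩

theorem Reach.loop {c N : ℕ} (I : ℕ → Config → Prop)
    (hI : ∀ i < N, ∀ s, I i s → Reach P ω c (I (i + 1)) s) (h : I 0 s) :
    Reach P ω (N * c) (I N) s := by
  induction N with
  | zero => exact Reach.refl h
  | succ N ih =>
    rw [Nat.succ_mul]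
    exact (ih fun i hi => hI i (by lia)).trans (hI N (by lia))

/-- Leaving a bounded loop that can also stop early. -/
theorem Reach.loop_or {c N : ℕ} (I : ℕ → Config → Prop) (J : Config → Prop)
    (hI : ∀ i < N, ∀ s, I i s → Reach P ω c (fun s => I (i + 1) s ∨ J s) s) (h : I 0 s) :
    Reach P ω (N * c) (fun s => I N s ∨ J s) s := by
  refine Reach.loop (fun i s => I i s ∨ J s) (fun i hi s hs => ?_) (Or.inl h)
  exact hs.elim (hI i hi s) fun hJ => Reach.refl (Or.inr hJ)

theorem Reach.step_of {i : Instr} (hs : s.answer = none) (hP : P[s.pc]? = some i)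
    (h : Reach P ω T A (i.exec ω s)) : Reach P ω (T + 1) A s := by
  obtain ⟨t, ht, hA⟩ := h
  refine ⟨t + 1, by lia, ?_⟩
  rw [Function.iterate_succ_apply]
  have : step P ω s = i.exec ω s := by simp [step, hs, hP]
  rwa [this]

/-! ### Symbolic execution: one rule per instruction, with overflow conditions -/

variable {pc u d a b l x y : ℕ} {reg mem : ℕ → ℕ}

theorem Reach.const {c : ℕ} (hP : P[pc]? = some (.const d c)) (hc : c < 2 ^ W)
    (h : Reach P ω T A ⟨pc + 1, Function.update reg d c, mem, u, none⟩) :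
    Reach P ω (T + 1) A ⟨pc, reg, mem, u, none⟩ :=
  Reach.step_of rfl hP (by simpa [Instr.exec, Nat.mod_eq_of_lt hc] using h)

theorem Reach.copy (hP : P[pc]? = some (.copy d a)) (ha : reg a = x)
    (h : Reach P ω T A ⟨pc + 1, Function.update reg d x, mem, u, none⟩) :
    Reach P ω (T + 1) A ⟨pc, reg, mem, u, none⟩ :=
  Reach.step_of rfl hP (by simpa [Instr.exec, ha] using h)

theorem Reach.add (hP : P[pc]? = some (.op .add d a b)) (ha : reg a = x) (hb : reg b = y)
    (hv : x + y < 2 ^ W)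
    (h : Reach P ω T A ⟨pc + 1, Function.update reg d (x + y), mem, u, none⟩) :
    Reach P ω (T + 1) A ⟨pc, reg, mem, u, none⟩ :=
  Reach.step_of rfl hP
    (by simpa [Instr.exec, BinOp.eval, ha, hb, Nat.mod_eq_of_lt hv] using h)

theorem Reach.sub (hP : P[pc]? = some (.op .sub d a b)) (ha : reg a = x) (hb : reg b = y)
    (hv : x < 2 ^ W)
    (h : Reach P ω T A ⟨pc + 1, Function.update reg d (x - y), mem, u, none⟩) :
    Reach P ω (T + 1) A ⟨pc, reg, mem, u, none⟩ :=
  Reach.step_of rfl hP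
    (by simpa [Instr.exec, BinOp.eval, ha, hb,
      Nat.mod_eq_of_lt ((Nat.sub_le x y).trans_lt hv)] using h)

theorem Reach.mul (hP : P[pc]? = some (.op .mul d a b)) (ha : reg a = x) (hb : reg b = y)
    (hv : x * y < 2 ^ W)
    (h : Reach P ω T A ⟨pc + 1, Function.update reg d (x * y), mem, u, none⟩) :
    Reach P ω (T + 1) A ⟨pc, reg, mem, u, none⟩ :=
  Reach.step_of rfl hP
    (by simpa [Instr.exec, BinOp.eval, ha, hb, Nat.mod_eq_of_lt hv] using h)

theorem Reach.div (hP : P[pc]? = some (.op .div d a b)) (ha : reg a = x) (hb : reg b = y)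
    (hv : x < 2 ^ W)
    (h : Reach P ω T A ⟨pc + 1, Function.update reg d (x / y), mem, u, none⟩) :
    Reach P ω (T + 1) A ⟨pc, reg, mem, u, none⟩ :=
  Reach.step_of rfl hP
    (by simpa [Instr.exec, BinOp.eval, ha, hb,
      Nat.mod_eq_of_lt ((Nat.div_le_self x y).trans_lt hv)] using h)

theorem Reach.rem (hP : P[pc]? = some (.op .rem d a b)) (ha : reg a = x) (hb : reg b = y)
    (hv : x < 2 ^ W)
    (h : Reach P ω T A ⟨pc + 1, Function.update reg d (x % y), mem, u, none⟩) :
    Reach P ω (T + 1) A ⟨pc, reg, mem, u, none⟩ :=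
  Reach.step_of rfl hP
    (by simpa [Instr.exec, BinOp.eval, ha, hb,
      Nat.mod_eq_of_lt ((Nat.mod_le x y).trans_lt hv)] using h)

theorem Reach.rand (hP : P[pc]? = some (.rand d))
    (h : Reach P ω T A ⟨pc + 1, Function.update reg d (ω u), mem, u + 1, none⟩) :
    Reach P ω (T + 1) A ⟨pc, reg, mem, u, none⟩ :=
  Reach.step_of rfl hP h

theorem Reach.load (hP : P[pc]? = some (.load d a)) (ha : reg a = x) (hx : mem x = y)
    (h : Reach P ω T A ⟨pc + 1, Function.update reg d y, mem, u, none⟩) :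
    Reach P ω (T + 1) A ⟨pc, reg, mem, u, none⟩ :=
  Reach.step_of rfl hP (by simpa [Instr.exec, ha, hx] using h)

theorem Reach.store (hP : P[pc]? = some (.store a b)) (ha : reg a = x) (hb : reg b = y)
    (h : Reach P ω T A ⟨pc + 1, reg, Function.update mem x y, u, none⟩) :
    Reach P ω (T + 1) A ⟨pc, reg, mem, u, none⟩ :=
  Reach.step_of rfl hP (by simpa [Instr.exec, ha, hb] using h)

theorem Reach.jump (hP : P[pc]? = some (.jump l)) (h : Reach P ω T A ⟨l, reg, mem, u, none⟩) :
    Reach P ω (T + 1) A ⟨pc, reg, mem, u, none⟩ :=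
  Reach.step_of rfl hP h

theorem Reach.jumpEq_pos (hP : P[pc]? = some (.jumpEq a b l)) (hab : reg a = reg b)
    (h : Reach P ω T A ⟨l, reg, mem, u, none⟩) :
    Reach P ω (T + 1) A ⟨pc, reg, mem, u, none⟩ :=
  Reach.step_of rfl hP (by simpa [Instr.exec, hab] using h)

theorem Reach.jumpEq_neg (hP : P[pc]? = some (.jumpEq a b l)) (hab : reg a ≠ reg b)
    (h : Reach P ω T A ⟨pc + 1, reg, mem, u, none⟩) :
    Reach P ω (T + 1) A ⟨pc, reg, mem, u, none⟩ :=
  Reach.step_of rfl hP (by simpa [Instr.exec, hab] using h)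

theorem Reach.jumpLt_pos (hP : P[pc]? = some (.jumpLt a b l)) (hab : reg a < reg b)
    (h : Reach P ω T A ⟨l, reg, mem, u, none⟩) :
    Reach P ω (T + 1) A ⟨pc, reg, mem, u, none⟩ :=
  Reach.step_of rfl hP (by simpa [Instr.exec, hab] using h)

theorem Reach.jumpLt_neg (hP : P[pc]? = some (.jumpLt a b l)) (hab : ¬ reg a < reg b)
    (h : Reach P ω T A ⟨pc + 1, reg, mem, u, none⟩) :
    Reach P ω (T + 1) A ⟨pc, reg, mem, u, none⟩ :=
  Reach.step_of rfl hP (by simpa [Instr.exec, hab] using h)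

theorem Reach.halt {r : Bool} (hP : P[pc]? = some (.halt r)) :
    Reach P ω (T + 1) (fun s => s.answer = some r) ⟨pc, reg, mem, u, none⟩ :=
  Reach.step_of rfl hP (Reach.refl rfl)

/-- A stopped machine is a fixed point of `step`, so an early answer persists to time T. -/
theorem answerWithin_of_reach {r : Bool} (h : Reach P ω T (fun s => s.answer = some r) s) :
    answerWithin P ω s T = some r := by
  obtain ⟨t, ht, hA⟩ := h
  obtain ⟨d, rfl⟩ := Nat.exists_eq_add_of_le ht
  rw [answerWithin, add_comm, Function.iterate_add_apply]
  set s' := (step P ω)^[t] s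
  have : step P ω s' = s' := by simp [step, hA]
  rwa [Function.iterate_fixed this]

end Reach

/-! ### Numbers in base `D` -/

/-- The digit of `y` at place `l` in base `D`. -/
def limb (D y l : ℕ) : ℕ := y / D ^ l % D

/-- The carry into place `l` in the computation of `y + x * z` in base `D`. -/
def carry (D x y z l : ℕ) : ℕ := (y % D ^ l + x * (z % D ^ l)) / D ^ l

theorem carry_zero (D x y z : ℕ) : carry D x y z 0 = 0 := by simp [carry, Nat.mod_one]

/-- This keeps z_l·x + y_l + carry below D·X + D + X, the quantity that must fit into a machine
word. -/
theorem carry_le {D : ℕ} (hD : 0 < D) (x y z l : ℕ) : carry D x y z l ≤ x := by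
  have hpos : 0 < D ^ l := by positivity
  refine Nat.lt_succ_iff.1 ((Nat.div_lt_iff_lt_mul hpos).2 ?_)
  have h1 := Nat.mod_lt y hpos
  have h2 := Nat.mul_le_mul_left x (Nat.mod_lt z hpos).le
  rw [Nat.succ_mul]
  lia

theorem limb_lt {D : ℕ} (hD : 0 < D) (y l : ℕ) : limb D y l < D := Nat.mod_lt _ hD

/-- The column sum of schoolbook arithmetic: its quotient by D is the next carry and its remainder
is the digit of the result. -/
theorem mod_pow_succ_add_mul_div {D : ℕ} (hD : 0 < D) (x y z l : ℕ) :
    (y % D ^ (l + 1) + x * (z % D ^ (l + 1))) / D ^ l =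
      limb D z l * x + limb D y l + carry D x y z l := by
  have hpos : 0 < D ^ l := by positivity
  rw [Nat.mod_pow_succ, Nat.mod_pow_succ, carry, limb, limb]
  have : y % D ^ l + D ^ l * (y / D ^ l % D) + x * (z % D ^ l + D ^ l * (z / D ^ l % D)) =
      (y % D ^ l + x * (z % D ^ l)) + D ^ l * (z / D ^ l % D * x + y / D ^ l % D) := by ring
  rw [this, Nat.add_mul_div_left _ _ hpos]
  ring

theorem carry_succ {D : ℕ} (hD : 0 < D) (x y z l : ℕ) :
    carry D x y z (l + 1) = (limb D z l * x + limb D y l + carry D x y z l) / D := by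
  rw [← mod_pow_succ_add_mul_div hD, Nat.div_div_eq_div_mul, carry, pow_succ]

theorem limb_add_mul {D : ℕ} (hD : 0 < D) (x y z l : ℕ) :
    limb D (y + x * z) l = (limb D z l * x + limb D y l + carry D x y z l) % D := by
  rw [← mod_pow_succ_add_mul_div hD, limb]
  have hpos : 0 < D ^ l := by positivity
  have h : y + x * z = (y % D ^ (l + 1) + x * (z % D ^ (l + 1))) +
      D ^ l * (D * (y / D ^ (l + 1) + x * (z / D ^ (l + 1)))) := by
    conv_lhs => rw [← Nat.mod_add_div y (D ^ (l + 1)), ← Nat.mod_add_div z (D ^ (l + 1))]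
    ring
  rw [h, Nat.add_mul_div_left _ _ hpos, Nat.add_mul_mod_self_left]

theorem eq_of_limb_eq {D k y z : ℕ} (hy : y < D ^ k) (hz : z < D ^ k)
    (h : ∀ l < k, limb D y l = limb D z l) : y = z := by
  have key : ∀ l ≤ k, y % D ^ l = z % D ^ l := by
    intro l hl
    induction l with
    | zero => simp [Nat.mod_one]
    | succ l ih =>
      have := h l hl
      rw [limb, limb] at this
      rw [Nat.mod_pow_succ, Nat.mod_pow_succ, ih (by lia), this]
  have := key k le_rfl
  rwa [Nat.mod_eq_of_lt hy, Nat.mod_eq_of_lt hz] at this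

end WordRAM

namespace WordRAM

/-! ### The program

The weights `x a j` of the letters `a` at the places `j` are random numbers below `X = 4 ^ s`, where
`2 ^ s > n`. For both words and every `j ≤ k`, the weighted number of the scattered factors of
length `j` is computed exactly, as a number with `k` digits in base `D = 8 ^ s`.

Registers: `0` is `n`, `1` is `k`, `3` is `1`, `5` is `X`, `6` is `D`, `8` is `k² + k`, the number
of digits of the results for one word. Memory: the letters occupy the cells below register `7`, the
results for the first word start at register `7`, those for the second one at register `9`, and the
weights at register `10`. -/

/-- The Monte-Carlo test for `k`-binomial equivalence. -/
def binomTest : Program :=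
  [ -- 0: answer at once if `k = 0`
    .const 3 1, .jumpLt 2 1 3, .halt true,
    -- 3: the least power of two greater than `n`
    .const 4 1, .jumpLt 0 4 7, .op .add 4 4 4, .jump 4,
    -- 7: parameters
    .op .mul 5 4 4, .op .mul 6 5 4, .op .add 7 0 0, .op .mul 8 1 1, .op .add 8 8 1,
    .op .add 9 7 8, .op .add 10 9 8, .store 7 3, .store 9 3,
    -- 16: random weights for the letters that occur
    .jumpEq 12 7 29, .load 13 12, .op .mul 13 13 1, .op .add 13 13 10, .op .add 14 13 1,
    .jumpEq 13 14 27, .rand 15, .op .rem 15 15 5, .store 13 15, .op .add 13 13 3, .jump 21,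
    .op .add 12 12 3, .jump 16,
    -- 29: read the letters of both words
    .const 12 0, .copy 11 7,
    .jumpEq 12 7 64, .jumpLt 12 0 34, .copy 11 9,
    .load 13 12, .op .mul 13 13 1, .op .add 13 13 10, .op .add 13 13 1, .op .mul 14 1 1,
    .op .add 14 14 11,
    -- 40: update the results for all lengths, the longest first
    .jumpEq 14 11 62, .op .sub 13 13 3, .load 15 13, .op .sub 16 14 1,
    -- 44: add a multiple of one number to another one
    .const 18 0, .op .add 19 14 1, .copy 20 14, .copy 21 16,
    .jumpEq 20 19 60, .load 22 21, .op .mul 22 22 15, .load 23 20, .op .add 22 22 23,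
    .op .add 22 22 18, .op .rem 23 22 6, .store 20 23, .op .div 18 22 6, .op .add 20 20 3,
    .op .add 21 21 3, .jump 48,
    .copy 14 16, .jump 40,
    .op .add 12 12 3, .jump 31,
    -- 64: compare
    .copy 20 7, .copy 21 9, .jumpEq 20 9 74, .load 22 20, .load 23 21, .jumpEq 22 23 71,
    .halt false, .op .add 20 20 3, .op .add 21 21 3, .jump 66,
    .halt true]

/-- The sizes for which the computation does not overflow. -/
structure Params (σ n k W X D : ℕ) : Prop where
  k_pos : 0 < k
  k_le : k ≤ n
  X_pos : 0 < X
  D_pos : 0 < D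
  one_lt : 1 < 2 ^ W
  mul_lt : n * X < D
  digit_lt : D * X + D + X < 2 ^ W
  addr_lt : n + n + 2 * (k * k + k) + σ * k + k < 2 ^ W

/-- The registers that do not change after the initialisation. -/
structure Env (n k X D : ℕ) (reg : ℕ → ℕ) : Prop where
  r0 : reg 0 = n
  r1 : reg 1 = k
  r3 : reg 3 = 1
  r5 : reg 5 = X
  r6 : reg 6 = D
  r7 : reg 7 = n + n
  r8 : reg 8 = k * k + k
  r9 : reg 9 = n + n + (k * k + k)
  r10 : reg 10 = n + n + (k * k + k) + (k * k + k)

theorem Env.congr {n k X D : ℕ} {reg reg' : ℕ → ℕ} (h : Env n k X D reg)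
    (hr : ∀ r < 11, reg' r = reg r) : Env n k X D reg' where
  r0 := (hr 0 (by lia)).trans h.r0
  r1 := (hr 1 (by lia)).trans h.r1
  r3 := (hr 3 (by lia)).trans h.r3
  r5 := (hr 5 (by lia)).trans h.r5
  r6 := (hr 6 (by lia)).trans h.r6
  r7 := (hr 7 (by lia)).trans h.r7
  r8 := (hr 8 (by lia)).trans h.r8
  r9 := (hr 9 (by lia)).trans h.r9
  r10 := (hr 10 (by lia)).trans h.r10

/-! ### Adding a multiple of a long number, and processing one letter -/

section

variable {σ n k W X D : ℕ} {ω : ℕ → Fin (2 ^ W)}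

/-- Schoolbook arithmetic in place on two adjacent numbers, z below and y above it. A carry out of
the top digit is dropped; that the stored digits determine the result follows later from its size.
-/
theorem reach_addMul (hp : Params σ n k W X D) {reg₀ mem₀ : ℕ → ℕ} {u q x y z : ℕ}
    (hE : Env n k X D reg₀) (hx : x < X) (hq : q + k + k < 2 ^ W)
    (h14 : reg₀ 14 = q + k) (h15 : reg₀ 15 = x) (h16 : reg₀ 16 = q)
    (hy : ∀ l < k, mem₀ (q + k + l) = limb D y l) (hz : ∀ l < k, mem₀ (q + l) = limb D z l) :
    Reach binomTest ω (k * 12 + 5)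
      (At 60 u fun reg mem => (∀ r < 18, reg r = reg₀ r) ∧
        mem = fun a => if q + k ≤ a ∧ a < q + k + k then limb D (y + x * z) (a - (q + k))
          else mem₀ a)
      ⟨44, reg₀, mem₀, u, none⟩ := by
  have hone := hp.one_lt
  have hD := hp.D_pos
  let R (l : ℕ) (reg mem : ℕ → ℕ) : Prop :=
    (∀ r < 18, reg r = reg₀ r) ∧ reg 18 = carry D x y z l ∧ reg 19 = q + k + k ∧
      reg 20 = q + k + l ∧ reg 21 = q + l ∧
      mem = fun a => if q + k ≤ a ∧ a < q + k + l then limb D (y + x * z) (a - (q + k))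
        else mem₀ a
  have hinit : Reach binomTest ω 4 (At 48 u (R 0)) ⟨44, reg₀, mem₀, u, none⟩ := by
    refine Reach.const rfl (by lia) ?_
    refine Reach.add (x := q + k) (y := k) rfl (by simp [h14]) (by simp [hE.r1]) hq ?_
    refine Reach.copy (x := q + k) rfl (by simp [h14]) ?_
    refine Reach.copy (x := q) rfl (by simp [h16]) ?_
    refine Reach.refl ⟨_, _, rfl, ?_, ?_, ?_, ?_, ?_, ?_⟩
    · intro r hr
      repeat rw [Function.update_of_ne (by lia)]
    · simp [carry_zero]
    · simp
    · simp
    · simp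
    · funext a
      rw [if_neg (by lia)]
  have hbody : ∀ l < k, ∀ s, At 48 u (R l) s → Reach binomTest ω 12 (At 48 u (R (l + 1))) s := by
    rintro l hl _ ⟨reg, mem, rfl, hfr, h18, h19, h20, h21, hmem⟩
    have hE' : Env n k X D reg := hE.congr fun r hr => hfr r (by lia)
    have h15' : reg 15 = x := (hfr 15 (by lia)).trans h15
    have hzl : mem (q + l) = limb D z l := by
      rw [hmem, ← hz l hl]
      exact if_neg (by lia)
    have hyl : mem (q + k + l) = limb D y l := by
      rw [hmem, ← hy l hl]
      exact if_neg (by lia)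
    have hc := carry_le hD x y z l
    have hly := limb_lt hD y l
    have hlz := limb_lt hD z l
    have hprod : limb D z l * x ≤ D * X := Nat.mul_le_mul hlz.le hx.le
    have hdig := hp.digit_lt
    refine Reach.jumpEq_neg rfl (by rw [h20, h19]; lia) ?_
    refine Reach.load (x := q + l) rfl h21 hzl ?_
    refine Reach.mul (x := limb D z l) (y := x) rfl (by simp) (by simp [h15']) (by lia) ?_
    refine Reach.load (x := q + k + l) rfl (by simp [h20]) hyl ?_
    refine Reach.add (x := limb D z l * x) (y := limb D y l) rfl (by simp) (by simp) (by lia) ?_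
    refine Reach.add (x := limb D z l * x + limb D y l) (y := carry D x y z l) rfl (by simp)
      (by simp [h18]) (by lia) ?_
    refine Reach.rem (x := limb D z l * x + limb D y l + carry D x y z l) (y := D) rfl (by simp)
      (by simp [hE'.r6]) (by lia) ?_
    refine Reach.store (x := q + k + l) (y := limb D (y + x * z) l) rfl (by simp [h20])
      (by simp [limb_add_mul hD]) ?_
    refine Reach.div (x := limb D z l * x + limb D y l + carry D x y z l) (y := D) rfl (by simp)
      (by simp [hE'.r6]) (by lia) ?_
    refine Reach.add (x := q + k + l) (y := 1) rfl (by simp [h20]) (by simp [hE'.r3]) (by lia) ?_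
    refine Reach.add (x := q + l) (y := 1) rfl (by simp [h21]) (by simp [hE'.r3]) (by lia) ?_
    refine Reach.jump rfl ?_
    refine Reach.refl ⟨_, _, rfl, ?_, ?_, ?_, ?_, ?_, ?_⟩
    · intro r hr
      repeat rw [Function.update_of_ne (by lia)]
      exact hfr r hr
    · simp [carry_succ hD]
    · simp [h19]
    · simp [add_assoc]
    · simp [add_assoc]
    · funext a
      rw [hmem, Function.update_apply]
      by_cases ha : a = q + k + l
      · rw [if_pos ha, if_pos (by lia), ha, Nat.add_sub_cancel_left]
      · rw [if_neg ha]
        by_cases ha' : q + k ≤ a ∧ a < q + k + l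
        · rw [if_pos ha', if_pos (by lia)]
        · rw [if_neg ha', if_neg (by lia)]
  refine ((hinit.trans fun s hs => (Reach.loop (fun l => At 48 u (R l)) hbody hs).trans
    (T' := 1) ?_)).mono (by lia)
  rintro _ ⟨reg, mem, rfl, hfr, h18, h19, h20, h21, hmem⟩
  refine Reach.jumpEq_pos rfl (by rw [h19, h20]) ?_
  exact Reach.refl ⟨_, _, rfl, hfr, hmem⟩

/-- The memory from the cell `F` on holds the numbers `g 0, …, g k`, each with `k` digits. -/
def Block (k D : ℕ) (mem : ℕ → ℕ) (F : ℕ) (g : ℕ → ℕ) : Prop :=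
  ∀ r ≤ k, ∀ l < k, mem (F + r * k + l) = limb D (g r) l

theorem Block.congr {mem mem' : ℕ → ℕ} {F : ℕ} {g : ℕ → ℕ} (h : Block k D mem F g)
    (hm : ∀ a, F ≤ a → a < F + (k * k + k) → mem' a = mem a) : Block k D mem' F g := by
  intro r hr l hl
  rw [hm _ (by lia) (by have := Nat.mul_le_mul_right k hr; lia)]
  exact h r hr l hl

/-- The numbers are updated from the longest length down, so that g j is still the old value when it
is added to g (j + 1). The number for length 0 never changes, which is where the loop stops. -/
theorem reach_update (hp : Params σ n k W X D) {reg₀ mem₀ : ℕ → ℕ} {u F t : ℕ}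
    {g g' x : ℕ → ℕ} (hE : Env n k X D reg₀) (ht : t + k < 2 ^ W)
    (hFt : F + (k * k + k) ≤ t)
    (h11 : reg₀ 11 = F) (h13 : reg₀ 13 = t + k) (h14 : reg₀ 14 = F + k * k)
    (hx : ∀ j < k, x j < X) (hmx : ∀ j < k, mem₀ (t + j) = x j)
    (hg : Block k D mem₀ F g) (hg0 : g' 0 = g 0)
    (hgs : ∀ j < k, g' (j + 1) = g (j + 1) + x j * g j) :
    Reach binomTest ω (k * (k * 12 + 11) + 1)
      (At 62 u fun reg mem => (∀ r < 13, reg r = reg₀ r) ∧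
        (∀ a, a < F ∨ F + (k * k + k) ≤ a → mem a = mem₀ a) ∧ Block k D mem F g')
      ⟨40, reg₀, mem₀, u, none⟩ := by
  have hone := hp.one_lt
  -- After i rounds exactly the numbers with index above k - i are new.
  let R (i : ℕ) (reg mem : ℕ → ℕ) : Prop :=
    (∀ r < 13, reg r = reg₀ r) ∧ reg 13 = t + (k - i) ∧ reg 14 = F + (k - i) * k ∧
      (∀ a, a < F ∨ F + (k * k + k) ≤ a → mem a = mem₀ a) ∧
      ∀ r ≤ k, ∀ l < k, mem (F + r * k + l) = limb D (if k - i < r then g' r else g r) l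
  have hbody : ∀ i < k, ∀ s, At 40 u (R i) s →
      Reach binomTest ω (k * 12 + 11) (At 40 u (R (i + 1))) s := by
    rintro i hi _ ⟨reg, mem, rfl, hfr, r13, r14, hout, hB⟩
    have hE' : Env n k X D reg := hE.congr fun r hr => hfr r (by lia)
    have r11 : reg 11 = F := (hfr 11 (by lia)).trans h11
    obtain ⟨j, hj⟩ : ∃ j, k - i = j + 1 := ⟨k - i - 1, by lia⟩
    have hj' : k - (i + 1) = j := by lia
    have hjk : j < k := by lia
    rw [hj] at r13 r14 hB
    have hjj : (j + 1) * k = j * k + k := by ring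
    have hjle : (j + 1) * k ≤ k * k := Nat.mul_le_mul_right k (by lia)
    refine Reach.mono (T := 4 + (k * 12 + 5) + 2) ?_ (by lia)
    refine Reach.trans (T := 4 + (k * 12 + 5)) (A := At 60 u fun reg' mem' =>
      (∀ r < 13, reg' r = reg r) ∧ reg' 13 = t + j ∧ reg' 16 = F + j * k ∧
      mem' = fun a => if F + j * k + k ≤ a ∧ a < F + j * k + k + k then
        limb D (g (j + 1) + x j * g j) (a - (F + j * k + k)) else mem a) ?_ ?_
    · rw [show 4 + (k * 12 + 5) = k * 12 + 5 + 1 + 1 + 1 + 1 by lia]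
      refine Reach.jumpEq_neg rfl ?_ ?_
      · rw [r14, r11]
        have := hp.k_pos
        lia
      refine Reach.sub (x := t + (j + 1)) (y := 1) rfl r13 (by simp [hE'.r3]) (by lia) ?_
      refine Reach.load (x := t + j) (y := x j) rfl (by simp) ?_ ?_
      · rw [hout _ (by lia), hmx j hjk]
      refine Reach.sub (x := F + (j + 1) * k) (y := k) rfl (by simp [r14]) (by simp [hE'.r1])
        (by lia) ?_
      have hsub : F + (j + 1) * k - k = F + j * k := by lia
      refine (reach_addMul hp (q := F + j * k) (x := x j) (y := g (j + 1)) (z := g j)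
        (hE'.congr ?_) (hx j hjk) (by lia) ?_ ?_ ?_ ?_ ?_).imp ?_
      · intro r hr
        repeat rw [Function.update_of_ne (by lia)]
      · simp [r14, hjj, add_assoc]
      · simp
      · simp [hsub]
      · intro l hl
        have := hB (j + 1) (by lia) l hl
        rwa [hjj, ← add_assoc, if_neg (by lia)] at this
      · intro l hl
        have := hB j (by lia) l hl
        rwa [if_neg (by lia)] at this
      · rintro _ ⟨reg', mem', rfl, hfr', hm'⟩
        refine ⟨_, _, rfl, ?_, ?_, ?_, hm'⟩
        · intro r hr
          rw [hfr' r (by lia)]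
          repeat rw [Function.update_of_ne (by lia)]
        · rw [hfr' 13 (by lia)]
          simp
        · rw [hfr' 16 (by lia)]
          simp [hsub]
    · rintro _ ⟨reg', mem', rfl, hfr', r13', r16', hm'⟩
      refine Reach.copy (x := F + j * k) rfl r16' ?_
      refine Reach.jump rfl ?_
      refine Reach.refl ⟨_, _, rfl, ?_, ?_, ?_, ?_, ?_⟩
      · intro r hr
        rw [Function.update_of_ne (by lia), hfr' r hr, hfr r hr]
      · simp [r13', hj']
      · simp [hj']
      · intro a ha
        rw [hm', ← hout a ha]
        exact if_neg (by lia)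
      · intro r hr l hl
        rw [hm', hj']
        have hrk : r * k + l < r * k + k := by lia
        rcases lt_trichotomy r (j + 1) with h | h | h
        · have := Nat.mul_le_mul_right k (show r + 1 ≤ j + 1 by lia)
          have h2 := hB r hr l hl
          rw [if_neg (by lia)] at h2
          simp only
          rw [if_neg (by lia), if_neg (by lia), h2]
        · subst h
          simp only
          rw [if_pos (by lia), if_pos (by lia), hgs j hjk]
          congr 1
          lia
        · have := Nat.mul_le_mul_right k (show j + 1 + 1 ≤ r by lia)
          have h2 := hB r hr l hl
          rw [if_pos (by lia)] at h2
          simp only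
          rw [if_neg (by lia), if_pos (by lia), h2]
  have h0 : At 40 u (R 0) ⟨40, reg₀, mem₀, u, none⟩ := by
    refine ⟨_, _, rfl, fun _ _ => rfl, by simpa using h13, by simpa using h14, fun _ _ => rfl, ?_⟩
    intro r hr l hl
    rw [if_neg (by lia)]
    exact hg r hr l hl
  refine (Reach.loop (fun i => At 40 u (R i)) hbody h0).trans ?_
  rintro _ ⟨reg, mem, rfl, hfr, r13, r14, hout, hB⟩
  refine Reach.jumpEq_pos rfl ?_ ?_
  · rw [r14, hfr 11 (by lia), h11]
    simp
  refine Reach.refl ⟨_, _, rfl, hfr, hout, ?_⟩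
  intro r hr l hl
  rw [hB r hr l hl]
  congr 1
  split_ifs with h
  · rfl
  · obtain rfl : r = 0 := by lia
    exact hg0.symm

end

end WordRAM

/-! ### Drawing the weights, reading the words, comparing the results -/

namespace WordRAM

open KBinomial

/-- The weight of the letter `a` at the place `j`, after the first `i` letters of `w` have been
given random weights. -/
def weight {W : ℕ} (ω : ℕ → Fin (2 ^ W)) (k X : ℕ) (w : ℕ → ℕ) : ℕ → ℕ → ℕ → ℕ
  | 0, _, _ => 0
  | i + 1, a, j => if a = w i then (ω (i * k + j) : ℕ) % X else weight ω k X w i a j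

theorem weight_lt {W : ℕ} (ω : ℕ → Fin (2 ^ W)) {k X : ℕ} (hX : 0 < X) (w : ℕ → ℕ) (i a j : ℕ) :
    weight ω k X w i a j < X := by
  induction i with
  | zero => exact hX
  | succ i ih =>
    rw [weight]
    split_ifs
    · exact Nat.mod_lt _ hX
    · exact ih

section

variable {σ n k W X D : ℕ} {ω : ℕ → Fin (2 ^ W)}

theorem reach_randomRow (hp : Params σ n k W X D) {reg₀ mem₀ : ℕ → ℕ} {u t : ℕ}
    (hE : Env n k X D reg₀) (ht : t + k < 2 ^ W) (h13 : reg₀ 13 = t) (h14 : reg₀ 14 = t + k) :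
    Reach binomTest ω (k * 6 + 1)
      (At 27 (u + k) fun reg mem => (∀ r < 13, reg r = reg₀ r) ∧
        mem = fun a => if t ≤ a ∧ a < t + k then (ω (u + (a - t)) : ℕ) % X else mem₀ a)
      ⟨21, reg₀, mem₀, u, none⟩ := by
  have hone := hp.one_lt
  let R (j : ℕ) (reg mem : ℕ → ℕ) : Prop :=
    (∀ r < 13, reg r = reg₀ r) ∧ reg 13 = t + j ∧ reg 14 = t + k ∧
      mem = fun a => if t ≤ a ∧ a < t + j then (ω (u + (a - t)) : ℕ) % X else mem₀ a
  have hbody : ∀ j < k, ∀ s, At 21 (u + j) (R j) s →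
      Reach binomTest ω 6 (At 21 (u + (j + 1)) (R (j + 1))) s := by
    rintro j hj _ ⟨reg, mem, rfl, hfr, r13, r14, hmem⟩
    have hE' : Env n k X D reg := hE.congr fun r hr => hfr r (by lia)
    refine Reach.jumpEq_neg rfl (by rw [r13, r14]; lia) ?_
    refine Reach.rand rfl ?_
    refine Reach.rem (x := ω (u + j)) (y := X) rfl (by simp) (by simp [hE'.r5]) (ω _).2 ?_
    refine Reach.store (x := t + j) (y := (ω (u + j) : ℕ) % X) rfl (by simp [r13]) (by simp) ?_
    refine Reach.add (x := t + j) (y := 1) rfl (by simp [r13]) (by simp [hE'.r3]) (by lia) ?_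
    refine Reach.jump rfl ?_
    refine Reach.refl ⟨_, _, rfl, ?_, ?_, ?_, ?_⟩
    · intro r hr
      repeat rw [Function.update_of_ne (by lia)]
      exact hfr r hr
    · simp [add_assoc]
    · simp [r14]
    · funext a
      rw [hmem, Function.update_apply]
      by_cases ha : a = t + j
      · rw [if_pos ha, if_pos (by lia), ha, Nat.add_sub_cancel_left]
      · rw [if_neg ha]
        by_cases ha' : t ≤ a ∧ a < t + j
        · rw [if_pos ha', if_pos (by lia)]
        · rw [if_neg ha', if_neg (by lia)]
  have h0 : At 21 (u + 0) (R 0) ⟨21, reg₀, mem₀, u, none⟩ := by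
    refine ⟨_, _, rfl, fun _ _ => rfl, h13, h14, ?_⟩
    funext a
    rw [if_neg (by lia)]
  refine (Reach.loop (fun j => At 21 (u + j) (R j)) hbody h0).trans ?_
  rintro _ ⟨reg, mem, rfl, hfr, r13, r14, hmem⟩
  refine Reach.jumpEq_pos rfl (by rw [r13, r14]) ?_
  exact Reach.refl ⟨_, _, rfl, hfr, hmem⟩

/-- Each occurrence of a letter overwrites its row of k weights, so no record of the letters already
seen is needed. Rows of letters not yet met are still zero, matching the value of `weight` there. -/
theorem reach_weights (hp : Params σ n k W X D) {reg₀ mem₀ w : ℕ → ℕ}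
    (hE : Env n k X D reg₀) (h12 : reg₀ 12 = 0)
    (hw : ∀ i < n + n, mem₀ i = w i) (hwσ : ∀ i < n + n, w i < σ)
    (h0 : ∀ a, n + n + (k * k + k) + (k * k + k) ≤ a → mem₀ a = 0) :
    Reach binomTest ω ((n + n) * (k * 6 + 8) + 1)
      (At 29 ((n + n) * k) fun reg mem => (∀ r < 11, reg r = reg₀ r) ∧
        (∀ a < n + n + (k * k + k) + (k * k + k), mem a = mem₀ a) ∧
        ∀ a < σ, ∀ j < k, mem (n + n + (k * k + k) + (k * k + k) + a * k + j) =
          weight ω k X w (n + n) a j)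
      ⟨16, reg₀, mem₀, 0, none⟩ := by
  have hone := hp.one_lt
  have haddr := hp.addr_lt
  set Tb := n + n + (k * k + k) + (k * k + k) with hTb
  let R (i : ℕ) (reg mem : ℕ → ℕ) : Prop :=
    (∀ r < 11, reg r = reg₀ r) ∧ reg 12 = i ∧ (∀ a < Tb, mem a = mem₀ a) ∧
      ∀ a < σ, ∀ j < k, mem (Tb + a * k + j) = weight ω k X w i a j
  have hbody : ∀ i < n + n, ∀ s, At 16 (i * k) (R i) s →
      Reach binomTest ω (k * 6 + 8) (At 16 ((i + 1) * k) (R (i + 1))) s := by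
    rintro i hi _ ⟨reg, mem, rfl, hfr, r12, hlow, htab⟩
    have hE' : Env n k X D reg := hE.congr hfr
    have hwi := hwσ i hi
    have hwk : w i * k + k ≤ σ * k := by
      have := Nat.mul_le_mul_right k (show w i + 1 ≤ σ from hwi)
      rwa [Nat.succ_mul] at this
    refine Reach.jumpEq_neg rfl (by rw [r12, hE'.r7]; lia) ?_
    refine Reach.load (x := i) (y := w i) rfl r12 (by rw [hlow i (by lia), hw i hi]) ?_
    refine Reach.mul (x := w i) (y := k) rfl (by simp) (by simp [hE'.r1]) (by lia) ?_
    refine Reach.add (x := w i * k) (y := Tb) rfl (by simp) (by simp [hE'.r10, hTb]) (by lia) ?_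
    refine Reach.add (x := w i * k + Tb) (y := k) rfl (by simp) (by simp [hE'.r1]) (by lia) ?_
    change Reach binomTest ω (k * 6 + 1 + 2) _ _
    refine (reach_randomRow hp (t := w i * k + Tb) (hE'.congr ?_) (by lia) ?_
      ?_).trans ?_
    · intro r hr
      repeat rw [Function.update_of_ne (by lia)]
    · simp
    · simp
    rintro _ ⟨reg', mem', rfl, hfr', hm'⟩
    have hfr'' : ∀ r < 13, reg' r = reg r := by
      intro r hr
      rw [hfr' r hr]
      repeat rw [Function.update_of_ne (by lia)]
    refine Reach.add (x := i) (y := 1) rfl (by rw [hfr'' 12 (by lia), r12])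
      (by rw [hfr'' 3 (by lia), hE'.r3]) (by lia) ?_
    refine Reach.jump rfl ?_
    rw [← Nat.succ_mul]
    refine Reach.refl ⟨_, _, rfl, ?_, ?_, ?_, ?_⟩
    · intro r hr
      rw [Function.update_of_ne (by lia), hfr'' r (by lia), hfr r hr]
    · simp
    · intro a ha
      rw [hm', ← hlow a ha]
      exact if_neg (by lia)
    · intro a ha j hj
      rw [hm', weight]
      simp only
      rcases lt_trichotomy a (w i) with h | h | h
      · have := Nat.mul_le_mul_right k (show a + 1 ≤ w i from h)
        rw [if_neg (by lia), if_neg (by lia), htab a ha j hj]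
      · rw [if_pos (by rw [h]; lia), if_pos h, h]
        congr 3
        lia
      · have := Nat.mul_le_mul_right k (show w i + 1 ≤ a from h)
        rw [if_neg (by lia), if_neg (by lia), htab a ha j hj]
  have hinit : At 16 (0 * k) (R 0) ⟨16, reg₀, mem₀, 0, none⟩ := by
    refine ⟨_, _, by rw [Nat.zero_mul], fun _ _ => rfl, h12, fun _ _ => rfl, ?_⟩
    intro a _ j _
    exact h0 _ (by lia)
  refine (Reach.loop (fun i => At 16 (i * k) (R i)) hbody hinit).trans ?_
  rintro _ ⟨reg, mem, rfl, hfr, r12, hlow, htab⟩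
  refine Reach.jumpEq_pos rfl (by rw [r12, (hE.congr hfr).r7]) ?_
  exact Reach.refl ⟨_, _, rfl, hfr, hlow, htab⟩

theorem reach_counts (hp : Params σ n k W X D) {reg₀ mem₀ w : ℕ → ℕ} {x : ℕ → ℕ → ℕ} {u : ℕ}
    (hE : Env n k X D reg₀) (hw : ∀ i < n + n, mem₀ i = w i) (hwσ : ∀ i < n + n, w i < σ)
    (hx : ∀ a j, x a j < X)
    (htab : ∀ a < σ, ∀ j < k, mem₀ (n + n + (k * k + k) + (k * k + k) + a * k + j) = x a j)
    (hB₁ : Block k D mem₀ (n + n) (weightedCount x w 0))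
    (hB₂ : Block k D mem₀ (n + n + (k * k + k)) (weightedCount x (fun a => w (n + a)) 0)) :
    Reach binomTest ω ((n + n) * (k * (k * 12 + 11) + 12) + 3)
      (At 64 u fun reg mem => Env n k X D reg ∧
        Block k D mem (n + n) (weightedCount x w n) ∧
        Block k D mem (n + n + (k * k + k)) (weightedCount x (fun a => w (n + a)) n))
      ⟨29, reg₀, mem₀, u, none⟩ := by
  have hone := hp.one_lt
  have haddr := hp.addr_lt
  have hkn := hp.k_le
  have hkpos := hp.k_pos
  set Tb := n + n + (k * k + k) + (k * k + k) with hTb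
  -- Here `min i n` and `i - n` count the letters read from the two words. Register 11 still points
  -- to the first block at i = n, since it is switched only inside that round.
  let R (i : ℕ) (reg mem : ℕ → ℕ) : Prop :=
    Env n k X D reg ∧ reg 11 = (if i ≤ n then n + n else n + n + (k * k + k)) ∧ reg 12 = i ∧
      (∀ a, a < n + n ∨ Tb ≤ a → mem a = mem₀ a) ∧
      Block k D mem (n + n) (weightedCount x w (min i n)) ∧
      Block k D mem (n + n + (k * k + k)) (weightedCount x (fun a => w (n + a)) (i - n))
  have hbody : ∀ i < n + n, ∀ s, At 31 u (R i) s →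
      Reach binomTest ω (k * (k * 12 + 11) + 12) (At 31 u (R (i + 1))) s := by
    rintro i hi _ ⟨reg, mem, rfl, hE', r11, r12, hout, hC₁, hC₂⟩
    have hwi := hwσ i hi
    have hwk : w i * k + k ≤ σ * k := by
      have := Nat.mul_le_mul_right k (show w i + 1 ≤ σ from hwi)
      rwa [Nat.succ_mul] at this
    have hmi : mem i = w i := by rw [hout i (by lia), hw i hi]
    have hrow : ∀ j < k, mem (w i * k + Tb + j) = x (w i) j := by
      intro j hj
      rw [hout _ (by lia), ← htab (w i) hwi j hj]
      congr 1
      lia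
    obtain ⟨F, hF⟩ : ∃ F, F = if i < n then n + n else n + n + (k * k + k) := ⟨_, rfl⟩
    have hFle : F + (k * k + k) ≤ Tb := by
      rw [hF]
      split_ifs <;> lia
    refine Reach.mono (T := 3 + (6 + (k * (k * 12 + 11) + 1) + 2)) ?_ (by lia)
    refine Reach.trans (T := 3) (A := At 34 u fun reg' mem' =>
      Env n k X D reg' ∧ reg' 11 = F ∧ reg' 12 = i ∧ mem' = mem) ?_ ?_
    · refine Reach.jumpEq_neg rfl (by rw [r12, hE'.r7]; lia) ?_
      by_cases hin : i < n
      · refine Reach.jumpLt_pos rfl (by rwa [r12, hE'.r0]) ?_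
        refine Reach.refl ⟨_, _, rfl, hE', ?_, r12, rfl⟩
        rw [r11, hF, if_pos hin.le, if_pos hin]
      · refine Reach.jumpLt_neg rfl (by rwa [r12, hE'.r0]) ?_
        refine Reach.copy (x := n + n + (k * k + k)) rfl hE'.r9 ?_
        refine Reach.refl ⟨_, _, rfl, hE'.congr ?_, ?_, ?_, rfl⟩
        · intro r hr
          rw [Function.update_of_ne (by lia)]
        · simp [hF, hin]
        · simp [r12]
    rintro _ ⟨reg', mem', rfl, hE'', r11', r12', rfl⟩
    refine Reach.trans (T := 6 + (k * (k * 12 + 11) + 1)) (A := At 62 u fun reg mem =>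
      Env n k X D reg ∧ reg 11 = F ∧ reg 12 = i ∧
      (∀ a, a < n + n ∨ Tb ≤ a → mem a = mem₀ a) ∧
      Block k D mem (n + n) (weightedCount x w (min (i + 1) n)) ∧
      Block k D mem (n + n + (k * k + k)) (weightedCount x (fun a => w (n + a)) (i + 1 - n))) ?_ ?_
    · rw [show 6 + (k * (k * 12 + 11) + 1) =
        (k * (k * 12 + 11) + 1) + 1 + 1 + 1 + 1 + 1 + 1 by ring]
      refine Reach.load (x := i) (y := w i) rfl r12' hmi ?_
      refine Reach.mul (x := w i) (y := k) rfl (by simp) (by simp [hE''.r1]) (by lia) ?_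
      refine Reach.add (x := w i * k) (y := Tb) rfl (by simp) (by simp [hE''.r10, hTb]) (by lia) ?_
      refine Reach.add (x := w i * k + Tb) (y := k) rfl (by simp) (by simp [hE''.r1]) (by lia) ?_
      refine Reach.mul (x := k) (y := k) rfl (by simp [hE''.r1]) (by simp [hE''.r1]) (by lia) ?_
      refine Reach.add (x := k * k) (y := F) rfl (by simp) (by simp [r11']) (by lia) ?_
      have hupd : ∀ r < 13, Function.update (Function.update (Function.update (Function.update
          (Function.update (Function.update reg' 13 (w i)) 13 (w i * k)) 13 (w i * k + Tb)) 13
          (w i * k + Tb + k)) 14 (k * k)) 14 (k * k + F) r = reg' r := by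
        intro r hr
        repeat rw [Function.update_of_ne (by lia)]
      by_cases hin : i < n
      · rw [if_pos hin] at hF
        rw [min_eq_left hin.le] at hC₁
        refine (reach_update hp (F := F) (t := w i * k + Tb) (x := x (w i))
          (g := weightedCount x w i) (g' := weightedCount x w (i + 1))
          (hE''.congr fun r hr => hupd r (by lia)) (by lia) (by lia)
          (by rw [hupd 11 (by lia), r11']) (by simp) (by simp [add_comm]) (fun j _ => hx _ _)
          hrow (by rwa [hF]) (by simp) (fun j _ => rfl)).imp ?_
        rintro _ ⟨reg, mem, rfl, hfr, hout', hB⟩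
        refine ⟨_, _, rfl, ?_, ?_, ?_, ?_, ?_, ?_⟩
        · exact hE''.congr fun r hr => (hfr r (by lia)).trans (hupd r (by lia))
        · rw [hfr 11 (by lia), hupd 11 (by lia), r11']
        · rw [hfr 12 (by lia), hupd 12 (by lia), r12']
        · intro a ha
          rw [hout' a (by lia), hout a ha]
        · rwa [hF, ← min_eq_left (show i + 1 ≤ n from hin)] at hB
        · rw [show i + 1 - n = i - n by lia]
          exact hC₂.congr fun a h1 h2 => hout' a (by lia)
      · rw [if_neg hin] at hF
        refine (reach_update hp (F := F) (t := w i * k + Tb) (x := x (w i))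
          (g := weightedCount x (fun a => w (n + a)) (i - n))
          (g' := weightedCount x (fun a => w (n + a)) (i - n + 1))
          (hE''.congr fun r hr => hupd r (by lia)) (by lia) (by lia)
          (by rw [hupd 11 (by lia), r11']) (by simp) (by simp [add_comm]) (fun j _ => hx _ _)
          hrow (by rwa [hF]) (by simp) (fun j _ => ?_)).imp ?_
        · rw [weightedCount, show n + (i - n) = i by lia]
        rintro _ ⟨reg, mem, rfl, hfr, hout', hB⟩
        refine ⟨_, _, rfl, ?_, ?_, ?_, ?_, ?_, ?_⟩
        · exact hE''.congr fun r hr => (hfr r (by lia)).trans (hupd r (by lia))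
        · rw [hfr 11 (by lia), hupd 11 (by lia), r11']
        · rw [hfr 12 (by lia), hupd 12 (by lia), r12']
        · intro a ha
          rw [hout' a (by lia), hout a ha]
        · rw [show min (i + 1) n = min i n by lia]
          exact hC₁.congr fun a h1 h2 => hout' a (by lia)
        · rwa [hF, ← show i + 1 - n = i - n + 1 by lia] at hB
    · rintro _ ⟨reg, mem, rfl, hE3, r11, r12, hout', hC₁', hC₂'⟩
      refine Reach.add (x := i) (y := 1) rfl r12 hE3.r3 (by lia) ?_
      refine Reach.jump rfl ?_
      refine Reach.refl ⟨_, _, rfl, hE3.congr ?_, ?_, ?_, hout', hC₁', hC₂'⟩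
      · intro r hr
        rw [Function.update_of_ne (by lia)]
      · simp [r11, hF]
      · simp
  have hinit : Reach binomTest ω 2 (At 31 u (R 0)) ⟨29, reg₀, mem₀, u, none⟩ := by
    refine Reach.const rfl (by lia) ?_
    refine Reach.copy (x := n + n) rfl (by simp [hE.r7]) ?_
    refine Reach.refl ⟨_, _, rfl, hE.congr ?_, ?_, ?_, fun _ _ => rfl, ?_, ?_⟩
    · intro r hr
      repeat rw [Function.update_of_ne (by lia)]
    · simp
    · simp
    · simpa using hB₁
    · simpa using hB₂
  refine (hinit.trans fun s hs => (Reach.loop (fun l => At 31 u (R l)) hbody hs).trans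
    (T' := 1) ?_).mono (by lia)
  rintro _ ⟨reg, mem, rfl, hE', r11, r12, hout, hC₁, hC₂⟩
  refine Reach.jumpEq_pos rfl (by rw [r12, hE'.r7]) ?_
  refine Reach.refl ⟨_, _, rfl, hE', ?_, ?_⟩
  · rwa [min_eq_right (by lia)] at hC₁
  · rwa [Nat.add_sub_cancel] at hC₂

theorem reach_compare (hp : Params σ n k W X D) {reg₀ mem₀ : ℕ → ℕ} {g₁ g₂ : ℕ → ℕ} {u : ℕ}
    (hE : Env n k X D reg₀) (hB₁ : Block k D mem₀ (n + n) g₁)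
    (hB₂ : Block k D mem₀ (n + n + (k * k + k)) g₂)
    (hg₁ : ∀ j ≤ k, g₁ j < D ^ k) (hg₂ : ∀ j ≤ k, g₂ j < D ^ k) :
    Reach binomTest ω ((k * k + k) * 7 + 4)
      (fun s => s.answer = some (decide (∀ j ≤ k, g₁ j = g₂ j)))
      ⟨64, reg₀, mem₀, u, none⟩ := by
  have hone := hp.one_lt
  have haddr := hp.addr_lt
  have hkpos := hp.k_pos
  set N := k * k + k with hN
  -- Cell c of a block is digit c % k of number c / k; the size bounds allow the numbers to be
  -- recovered from their k digits.
  have hiff : (∀ j ≤ k, g₁ j = g₂ j) ↔ ∀ c < N, mem₀ (n + n + c) = mem₀ (n + n + N + c) := by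
    constructor
    · intro h c hc
      have hck : c / k ≤ k := by
        rw [← Nat.lt_succ_iff, Nat.div_lt_iff_lt_mul hkpos, Nat.succ_mul]
        exact hc
      have h1 := hB₁ (c / k) hck (c % k) (Nat.mod_lt _ hkpos)
      have h2 := hB₂ (c / k) hck (c % k) (Nat.mod_lt _ hkpos)
      rw [add_assoc, Nat.div_add_mod'] at h1 h2
      rw [h1, h2, h _ hck]
    · intro h j hj
      refine eq_of_limb_eq (hg₁ j hj) (hg₂ j hj) fun l hl => ?_
      have := Nat.mul_le_mul_right k hj
      rw [← hB₁ j hj l hl, ← hB₂ j hj l hl, add_assoc, h _ (by lia), add_assoc (n + n + N)]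
  let R (c : ℕ) (reg mem : ℕ → ℕ) : Prop :=
    Env n k X D reg ∧ reg 20 = n + n + c ∧ reg 21 = n + n + N + c ∧ mem = mem₀ ∧
      ∀ c' < c, mem₀ (n + n + c') = mem₀ (n + n + N + c')
  have hbody : ∀ c < N, ∀ s, At 66 u (R c) s → Reach binomTest ω 7 (fun s => At 66 u (R (c + 1)) s ∨
      (s.answer = some false ∧ ¬ ∀ j ≤ k, g₁ j = g₂ j)) s := by
    rintro c hc _ ⟨reg, mem, rfl, hE', r20, r21, rfl, heq⟩
    refine Reach.jumpEq_neg rfl (by rw [r20, hE'.r9]; lia) ?_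
    refine Reach.load (x := n + n + c) rfl r20 rfl ?_
    refine Reach.load (x := n + n + N + c) rfl (by simp [r21]) rfl ?_
    by_cases h : mem (n + n + c) = mem (n + n + N + c)
    · refine Reach.jumpEq_pos rfl (by simp [h]) ?_
      refine Reach.add (x := n + n + c) (y := 1) rfl (by simp [r20]) (by simp [hE'.r3]) (by lia) ?_
      refine Reach.add (x := n + n + N + c) (y := 1) rfl (by simp [r21]) (by simp [hE'.r3])
        (by lia) ?_
      refine Reach.jump rfl ?_
      refine Reach.refl (Or.inl ⟨_, _, rfl, hE'.congr ?_, ?_, ?_, rfl, ?_⟩)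
      · intro r hr
        repeat rw [Function.update_of_ne (by lia)]
      · simp [add_assoc]
      · simp [add_assoc]
      · intro c' hc'
        rcases Nat.lt_succ_iff_lt_or_eq.1 hc' with h' | rfl
        · exact heq c' h'
        · exact h
    · refine Reach.jumpEq_neg rfl (by simp [h]) ?_
      refine Reach.imp (Reach.halt rfl) fun s hs => Or.inr ⟨hs, ?_⟩
      rw [hiff]
      exact fun hall => h (hall c hc)
  have hinit : Reach binomTest ω 2 (At 66 u (R 0)) ⟨64, reg₀, mem₀, u, none⟩ := by
    refine Reach.copy (x := n + n) rfl (by simp [hE.r7]) ?_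
    refine Reach.copy (x := n + n + N) rfl (by simp [hE.r9, hN]) ?_
    refine Reach.refl ⟨_, _, rfl, hE.congr ?_, ?_, ?_, rfl, ?_⟩
    · intro r hr
      repeat rw [Function.update_of_ne (by lia)]
    · simp
    · simp
    · simp
  refine (hinit.trans fun s hs => (Reach.loop_or (fun l => At 66 u (R l)) _ hbody hs).trans
    (T' := 2) ?_).mono (by lia)
  rintro s (⟨reg, mem, rfl, hE', r20, r21, rfl, heq⟩ | ⟨hs, hne⟩)
  · rw [← hiff] at heq
    rw [decide_eq_true heq]
    refine Reach.jumpEq_pos rfl (by rw [r20, hE'.r9]) ?_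
    exact Reach.halt rfl
  · rw [decide_eq_false hne]
    exact Reach.refl hs

end

end WordRAM

/-! ### Choice of the sizes, initialisation and the complete run -/

namespace WordRAM

open KBinomial

section

variable {σ n k W : ℕ}

/-- With B = 2^s ≤ N = 2^q, the largest intermediate value is of order D·X = B^5 ≤ N^5, and
addresses are of order N². Three further factors N ≥ 2 absorb the constants, hence the 8. -/
theorem params_of_clog_le (hk : 0 < k) (hkn : k ≤ n) (hW : 8 * Nat.clog 2 (n + σ + 2) ≤ W) :
    Params σ n k W (2 ^ n.size * 2 ^ n.size) (2 ^ n.size * 2 ^ n.size * 2 ^ n.size) := by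
  set q := Nat.clog 2 (n + σ + 2) with hq
  have hN : n + σ + 2 ≤ 2 ^ q := Nat.le_pow_clog (by norm_num) _
  have hB : 2 ^ n.size ≤ 2 ^ q :=
    Nat.pow_le_pow_right (by norm_num) (Nat.size_le.2 (by lia))
  have hnB : n < 2 ^ n.size := Nat.lt_size_self n
  have hNW : (2 ^ q) ^ 8 ≤ 2 ^ W := by
    rw [← pow_mul, mul_comm]
    exact Nat.pow_le_pow_right (by norm_num) hW
  set N := 2 ^ q
  set B := 2 ^ n.size
  have hN2 : 2 ≤ N := by lia
  have hXN : B * B ≤ N ^ 2 := by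
    calc B * B ≤ N * N := Nat.mul_le_mul hB hB
      _ = _ := by ring
  have hDN : B * B * B ≤ N ^ 3 := by
    calc B * B * B ≤ N ^ 2 * N := Nat.mul_le_mul hXN hB
      _ = _ := by ring
  have h8 : 8 * N ^ 5 ≤ N ^ 8 := by
    calc 8 * N ^ 5 = 2 ^ 3 * N ^ 5 := by norm_num
      _ ≤ N ^ 3 * N ^ 5 := Nat.mul_le_mul_right _ (Nat.pow_le_pow_left hN2 3)
      _ = _ := by ring
  have h25 : N ^ 2 ≤ N ^ 5 := Nat.pow_le_pow_right (by lia) (by norm_num)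
  have h35 : N ^ 3 ≤ N ^ 5 := Nat.pow_le_pow_right (by lia) (by norm_num)
  have h5 : 0 < N ^ 5 := by positivity
  refine ⟨hk, hkn, by positivity, by positivity, by lia, ?_, ?_, ?_⟩
  · rw [mul_comm]
    exact Nat.mul_lt_mul_of_pos_left hnB (by positivity)
  · have : B * B * B * (B * B) ≤ N ^ 5 := by
      calc _ ≤ N ^ 3 * N ^ 2 := Nat.mul_le_mul hDN hXN
        _ = _ := by ring
    lia
  · have h1 : k * k ≤ N ^ 2 := by
      rw [pow_two]
      exact Nat.mul_le_mul (by lia) (by lia)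
    have h2 : σ * k ≤ N ^ 2 := by
      rw [pow_two]
      exact Nat.mul_le_mul (by lia) (by lia)
    have h3 : 2 * N ≤ N ^ 2 := by
      rw [pow_two]
      exact Nat.mul_le_mul_right _ hN2
    lia

theorem reach_init {ω : ℕ → Fin (2 ^ W)} (w₁ w₂ : Fin n → Fin σ) (hk : 0 < k) (hkn : k ≤ n)
    (hW : 8 * Nat.clog 2 (n + σ + 2) ≤ W) :
    Reach binomTest ω (n * 3 + 13)
      (At 16 0 fun reg mem =>
        Env n k (2 ^ n.size * 2 ^ n.size) (2 ^ n.size * 2 ^ n.size * 2 ^ n.size) reg ∧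
        reg 12 = 0 ∧ mem = Function.update (Function.update (start k w₁ w₂).mem (n + n) 1)
          (n + n + (k * k + k)) 1)
      (start k w₁ w₂) := by
  have hp := params_of_clog_le hk hkn hW
  have hone := hp.one_lt
  have haddr := hp.addr_lt
  have hdig := hp.digit_lt
  set B := 2 ^ n.size with hB
  have hBpos : 0 < B := by positivity
  have hXD : B * B ≤ B * B * B := Nat.le_mul_of_pos_right _ hBpos
  have hsn : n.size ≤ n := Nat.size_le.2 Nat.lt_two_pow_self
  -- Register 4 doubles until it exceeds n, after `n.size` rounds; the crude bound `n.size ≤ n` is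
  -- enough for the running time.
  let R (i : ℕ) (reg mem : ℕ → ℕ) : Prop :=
    reg 0 = n ∧ reg 1 = k ∧ reg 3 = 1 ∧ reg 4 = 2 ^ i ∧ reg 12 = 0 ∧ mem = (start k w₁ w₂).mem
  have hinit : Reach binomTest ω 3 (At 4 0 (R 0)) (start k w₁ w₂) := by
    refine Reach.const rfl (by lia) ?_
    refine Reach.jumpLt_pos rfl (by simpa using hk) ?_
    refine Reach.const rfl (by lia) ?_
    refine Reach.refl ⟨_, _, rfl, ?_, ?_, ?_, ?_, ?_, rfl⟩ <;> simp
  have hbody : ∀ i < n.size, ∀ s, At 4 0 (R i) s → Reach binomTest ω 3 (At 4 0 (R (i + 1))) s := by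
    rintro i hi _ ⟨reg, mem, rfl, r0, r1, r3, r4, r12, hmem⟩
    have hin : 2 ^ i ≤ n := Nat.lt_size.1 hi
    refine Reach.jumpLt_neg rfl (by rw [r0, r4]; lia) ?_
    refine Reach.add (x := 2 ^ i) (y := 2 ^ i) rfl r4 r4 (by lia) ?_
    refine Reach.jump rfl ?_
    refine Reach.refl ⟨_, _, rfl, ?_, ?_, ?_, ?_, ?_, hmem⟩
    · simp [r0]
    · simp [r1]
    · simp [r3]
    · simp [pow_succ, mul_two]
    · simp [r12]
  refine (hinit.trans fun s hs => (Reach.loop (fun l => At 4 0 (R l)) hbody hs).trans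
    (T' := 10) ?_).mono (by lia)
  rintro _ ⟨reg, mem, rfl, r0, r1, r3, r4, r12, hmem⟩
  rw [← hB] at r4
  refine Reach.jumpLt_pos rfl (by rw [r0, r4]; exact Nat.lt_size_self n) ?_
  refine Reach.mul (x := B) (y := B) rfl r4 r4 (by lia) ?_
  refine Reach.mul (x := B * B) (y := B) rfl (by simp) (by simp [r4]) (by lia) ?_
  refine Reach.add (x := n) (y := n) rfl (by simp [r0]) (by simp [r0]) (by lia) ?_
  refine Reach.mul (x := k) (y := k) rfl (by simp [r1]) (by simp [r1]) (by lia) ?_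
  refine Reach.add (x := k * k) (y := k) rfl (by simp) (by simp [r1]) (by lia) ?_
  refine Reach.add (x := n + n) (y := k * k + k) rfl (by simp) (by simp) (by lia) ?_
  refine Reach.add (x := n + n + (k * k + k)) (y := k * k + k) rfl (by simp) (by simp) (by lia) ?_
  refine Reach.store (x := n + n) (y := 1) rfl (by simp) (by simp [r3]) ?_
  refine Reach.store (x := n + n + (k * k + k)) (y := 1) rfl (by simp) (by simp [r3]) ?_
  refine Reach.refl ⟨_, _, rfl, ?_, ?_, by rw [hmem]⟩
  · constructor <;> simp [r0, r1, r3]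
  · simp [r12]

theorem start_mem_lt (w₁ w₂ : Fin n → Fin σ) {i : ℕ} (hi : i < n + n) :
    (start k w₁ w₂).mem i < σ := by
  simp only [start]
  split_ifs with h1 h2
  · exact (w₁ _).2
  · exact (w₂ _).2
  · lia

theorem start_mem_of_le (w₁ w₂ : Fin n → Fin σ) {i : ℕ} (hi : n + n ≤ i) :
    (start k w₁ w₂).mem i = 0 := by
  simp only [start]
  rw [dif_neg (by lia), dif_neg (by lia)]

theorem start_mem_left (w₁ w₂ : Fin n → Fin σ) (i : Fin n) :
    (start k w₁ w₂).mem i = w₁ i := by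
  simp [start]

theorem start_mem_right (w₁ w₂ : Fin n → Fin σ) (i : Fin n) :
    (start k w₁ w₂).mem (n + i) = w₂ i := by
  simp [start]

theorem limb_one {D : ℕ} (hD : 1 < D) (l : ℕ) : limb D 1 l = if l = 0 then 1 else 0 := by
  split_ifs with h
  · simp [h, limb, Nat.mod_eq_of_lt hD]
  · rw [limb, Nat.div_eq_of_lt (Nat.one_lt_pow h hD), Nat.zero_mod]

/-- Before any letter is read the count is 1 for length 0 and 0 otherwise, so a single 1 in the
first cell of zeroed memory is correct. -/
theorem block_init {D F : ℕ} {x : ℕ → ℕ → ℕ} {w mem : ℕ → ℕ} (hD : 1 < D) (h1 : mem F = 1)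
    (h0 : ∀ a, F < a → a < F + (k * k + k) → mem a = 0) :
    Block k D mem F (weightedCount x w 0) := by
  intro r hr l hl
  cases r with
  | zero =>
    rw [weightedCount_zero_right, limb_one hD]
    split_ifs with h
    · simp [h, h1]
    · exact h0 _ (by lia) (by lia)
  | succ r =>
    have h2 := Nat.mul_le_mul_right k hr
    have h3 : 0 < (r + 1) * k := Nat.mul_pos (by lia) (by lia)
    rw [h0 _ (by lia) (by lia)]
    simp [weightedCount, limb]

/-- The count is at most (nX)^j, and nX < D. -/
theorem weightedCount_lt {X D : ℕ} {x : ℕ → ℕ → ℕ} {w : ℕ → ℕ} (hp : Params σ n k W X D)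
    (hx : ∀ a j, x a j < X) {j : ℕ} (hj : j ≤ k) : weightedCount x w n j < D ^ k := by
  have hn : 0 < n := hp.k_pos.trans_le hp.k_le
  calc weightedCount x w n j ≤ n.choose j * X ^ j := weightedCount_le fun _ _ _ _ => (hx _ _).le
    _ ≤ n ^ j * X ^ j := Nat.mul_le_mul_right _ (Nat.choose_le_pow n j)
    _ = (n * X) ^ j := (mul_pow _ _ _).symm
    _ ≤ (n * X) ^ k := Nat.pow_le_pow_right (Nat.mul_pos hn hp.X_pos) hj
    _ < D ^ k := Nat.pow_lt_pow_left hp.mul_lt hp.k_pos.ne'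

/-- The machine decides whether the weighted counts of both words agree for all lengths. -/
theorem reach_answer (ω : ℕ → Fin (2 ^ W)) (w₁ w₂ : Fin n → Fin σ) (hkn : k ≤ n)
    (hW : 8 * Nat.clog 2 (n + σ + 2) ≤ W) {w : ℕ → ℕ} (hw : w = (start k w₁ w₂).mem)
    {x : ℕ → ℕ → ℕ} (hx : x = weight ω k (2 ^ n.size * 2 ^ n.size) w (n + n)) :
    Reach binomTest ω (200 * (n * k ^ 2 + k ^ 4 + 1))
      (fun s => s.answer = some (decide (∀ j ≤ k,
        weightedCount x w n j = weightedCount x (fun a => w (n + a)) n j)))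
      (start k w₁ w₂) := by
  rcases Nat.eq_zero_or_pos k with rfl | hk
  · have hone : 1 < 2 ^ W := by
      have : 0 < Nat.clog 2 (n + σ + 2) := Nat.clog_pos (by norm_num) (by lia)
      exact Nat.one_lt_two_pow (by lia)
    rw [decide_eq_true (by simp)]
    refine Reach.mono (T := 3) ?_ (by lia)
    refine Reach.const rfl (by lia) ?_
    refine Reach.jumpLt_neg rfl (by simp) ?_
    exact Reach.halt rfl
  have hp := params_of_clog_le hk hkn hW
  set X := 2 ^ n.size * 2 ^ n.size
  set D := X * 2 ^ n.size
  have hD : 1 < D := lt_of_le_of_lt (Nat.mul_pos (hk.trans_le hkn) hp.X_pos) hp.mul_lt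
  have hxX : ∀ a j, x a j < X := fun a j => hx ▸ weight_lt ω hp.X_pos w (n + n) a j
  refine Reach.mono (T := (n * 3 + 13) + (((n + n) * (k * 6 + 8) + 1) +
    (((n + n) * (k * (k * 12 + 11) + 12) + 3) + ((k * k + k) * 7 + 4)))) ?_ ?_
  swap
  · have h1 : n ≤ n * k ^ 2 := Nat.le_mul_of_pos_right _ (by positivity)
    have h2 : n * k ≤ n * k ^ 2 := Nat.mul_le_mul_left _ (Nat.le_self_pow (by norm_num) k)
    have h3 : k ≤ n * k ^ 2 := (hkn.trans h1)
    have h4 : k * k ≤ n * k ^ 2 := (Nat.mul_le_mul_right k hkn).trans h2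
    have h5 : (n + n) * (k * 6 + 8) = 12 * (n * k) + 16 * n := by ring
    have h6 : (n + n) * (k * (k * 12 + 11) + 12) = 24 * (n * k ^ 2) + 22 * (n * k) + 24 * n := by
      ring
    rw [h5, h6]
    lia
  refine (reach_init w₁ w₂ hk hkn hW).trans ?_
  rintro _ ⟨reg, mem, rfl, hE, r12, hmem⟩
  have hmem0 : ∀ i < n + n, mem i = w i := by
    intro i hi
    rw [hmem, Function.update_of_ne (by lia), Function.update_of_ne (by lia), hw]
  have hzero : ∀ a, n + n < a → a ≠ n + n + (k * k + k) → mem a = 0 := by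
    intro a ha ha'
    rw [hmem, Function.update_of_ne ha', Function.update_of_ne (by lia),
      start_mem_of_le _ _ (by lia)]
  have hwσ : ∀ i < n + n, w i < σ := fun i hi => hw ▸ start_mem_lt w₁ w₂ hi
  refine (reach_weights hp hE r12 hmem0 hwσ fun a ha => hzero a (by lia) (by lia)).trans ?_
  rintro _ ⟨reg', mem', rfl, hfr, hlow, htab⟩
  rw [← hx] at htab
  refine (reach_counts hp (hE.congr hfr) (w := w) (x := x) ?_ hwσ hxX htab ?_ ?_).trans ?_
  · intro i hi
    rw [hlow i (by lia), hmem0 i hi]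
  · refine block_init hD ?_ fun a h1 h2 => ?_
    · rw [hlow _ (by lia), hmem, Function.update_of_ne (by lia), Function.update_self]
    · rw [hlow a (by lia), hzero a h1 (by lia)]
  · refine block_init hD ?_ fun a h1 h2 => ?_
    · rw [hlow _ (by lia), hmem, Function.update_self]
    · rw [hlow a (by lia), hzero a (by lia) (by lia)]
  rintro _ ⟨reg'', mem'', rfl, hE'', hB₁, hB₂⟩
  exact reach_compare hp hE'' hB₁ hB₂ (fun j hj => weightedCount_lt hp hxX hj)
    (fun j hj => weightedCount_lt hp hxX hj)

end

/-! ### The probability of error -/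

/-- L a is the last position of the letter a, whose draw survives. It does not depend on ω, and w (L
a) = a makes it injective on the letters that occur, so distinct weights come from distinct, hence
independent, random words. -/
theorem exists_weight_eq (k X : ℕ) (w : ℕ → ℕ) (N : ℕ) :
    ∃ L : ℕ → ℕ, ∀ i < N, L (w i) < N ∧ w (L (w i)) = w i ∧
      ∀ (W : ℕ) (ω : ℕ → Fin (2 ^ W)) (j : ℕ),
        weight ω k X w N (w i) j = (ω (L (w i) * k + j) : ℕ) % X := by
  induction N with
  | zero => exact ⟨id, by simp⟩
  | succ N ih =>
    obtain ⟨L, hL⟩ := ih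
    refine ⟨fun a => if a = w N then N else L a, fun i hi => ?_⟩
    by_cases h : w i = w N
    · simp [h, weight]
    · have hiN : i < N := lt_of_le_of_ne (Nat.lt_succ_iff.1 hi) fun h' => h (by rw [h'])
      obtain ⟨h1, h2, h3⟩ := hL i hiN
      simp only [h, if_false, weight]
      exact ⟨by lia, h2, h3⟩

open Finset MvPolynomial in
/-- The Schwartz–Zippel lemma for random words that are reduced modulo a divisor of `2 ^ W`. -/
theorem card_eval_mod_eq_zero_le {T W X : ℕ} (hX : X ∣ 2 ^ W) {p : MvPolynomial (Fin T) ℤ}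
    (hp : p ≠ 0) :
    (#{u : Fin T → Fin (2 ^ W) | eval (fun i => (((u i : ℕ) % X : ℕ) : ℤ)) p = 0} : ℝ) ≤
      p.totalDegree / X * (2 ^ W : ℝ) ^ T := by
  have hX0 : 0 < X := Nat.pos_of_dvd_of_pos hX (by positivity)
  obtain ⟨c, hc⟩ := hX
  let S : Finset ℤ := (range X).map Nat.castEmbedding
  have hS : #S = X := by simp [S]
  have hsz := schwartz_zippel_totalDegree hp S
  set Z := {f ∈ Fintype.piFinset fun _ : Fin T ↦ S | eval f p = 0} with hZ
  -- Each residue mod X has c = 2^W / X preimages among the words, so reduction keeps the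
  -- distribution uniform.
  have hcard : #{u : Fin T → Fin (2 ^ W) | eval (fun i => (((u i : ℕ) % X : ℕ) : ℤ)) p = 0} ≤
      c ^ T * #Z := by
    refine card_le_mul_card_image_of_maps_to
      (f := fun u : Fin T → Fin (2 ^ W) => fun i => (((u i : ℕ) % X : ℕ) : ℤ)) ?_ _ ?_
    · intro u hu
      simp only [mem_filter, mem_univ, true_and] at hu
      simp only [hZ, mem_filter, Fintype.mem_piFinset]
      exact ⟨fun i => mem_map.2 ⟨_, mem_range.2 (Nat.mod_lt _ hX0), rfl⟩, hu⟩
    · intro f _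
      calc _ ≤ #(Fintype.piFinset fun i : Fin T =>
            ({a : Fin (2 ^ W) | (((a : ℕ) % X : ℕ) : ℤ) = f i} : Finset (Fin (2 ^ W)))) := by
            refine card_le_card fun u hu => ?_
            simp only [mem_filter, mem_univ, true_and] at hu
            simp only [Fintype.mem_piFinset, mem_filter, mem_univ, true_and]
            exact fun i => congrFun hu.2 i
        _ ≤ c ^ T := by
            rw [Fintype.card_piFinset]
            refine (prod_le_prod' fun i _ => (?_ : _ ≤ c)).trans (by simp)
            rw [← card_range c]
            refine card_le_card_of_injOn (fun a => (a : ℕ) / X) ?_ ?_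
            · intro a _
              simp only [coe_range, Set.mem_Iio]
              exact Nat.div_lt_of_lt_mul (hc ▸ a.2)
            · intro a ha b hb hab
              simp only [coe_filter, mem_univ, true_and, Set.mem_ofPred_eq] at ha hb hab
              have h : (a : ℕ) % X = (b : ℕ) % X := by exact_mod_cast ha.trans hb.symm
              ext
              rw [← Nat.div_add_mod (a : ℕ) X, ← Nat.div_add_mod (b : ℕ) X, hab, h]
  rw [hS] at hsz
  have hsz' : (#Z : ℝ) / (X : ℝ) ^ T ≤ p.totalDegree / X := by
    have h := (NNRat.cast_le (K := ℝ)).2 hsz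
    push_cast at h
    exact h
  have hXT : (0 : ℝ) < (X : ℝ) ^ T := by positivity
  rw [div_le_iff₀ hXT] at hsz'
  calc _ ≤ ((c ^ T * #Z : ℕ) : ℝ) := by exact_mod_cast hcard
    _ = (c : ℝ) ^ T * #Z := by push_cast; ring
    _ ≤ (c : ℝ) ^ T * (p.totalDegree / X * (X : ℝ) ^ T) := by gcongr
    _ = p.totalDegree / X * ((X * c : ℕ) : ℝ) ^ T := by push_cast; ring
    _ = _ := by rw [← hc]; push_cast; ring

theorem totalDegree_weightedCount_le {τ : Type*} {x : ℕ → ℕ → MvPolynomial τ ℤ}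
    (hx : ∀ a j, (x a j).totalDegree ≤ 1) (w : ℕ → ℕ) (i j : ℕ) :
    (weightedCount x w i j).totalDegree ≤ j := by
  induction i generalizing j with
  | zero => cases j <;> simp [weightedCount]
  | succ i ih =>
    cases j with
    | zero => simp
    | succ j =>
      rw [weightedCount]
      refine (MvPolynomial.totalDegree_add _ _).trans (max_le (ih _) ?_)
      refine (MvPolynomial.totalDegree_mul _ _).trans ?_
      have h1 := hx (w i) j
      have h2 := ih j
      lia

open Finset in
/-- The probability that different binomial coefficients go unnoticed. -/
theorem card_weightedCount_eq_le {σ n k m T W X : ℕ} {w : ℕ → ℕ} {w₁ w₂ : Fin n → Fin σ}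
    (hw₁ : ∀ a : Fin n, w a = w₁ a) (hw₂ : ∀ a : Fin n, w (n + a) = w₂ a) (hX : X ∣ 2 ^ W)
    (hmk : m ≤ k) (hT : (n + n) * k ≤ T) {v : Fin m → Fin σ} (hv : binom w₁ v ≠ binom w₂ v) :
    (#{u : Fin T → Fin (2 ^ W) |
      weightedCount (weight (extend u) k X w (n + n)) w n m =
        weightedCount (weight (extend u) k X w (n + n)) (fun a => w (n + a)) n m} : ℝ) ≤
      m / X * (2 ^ W : ℝ) ^ T := by
  obtain ⟨L, hL⟩ := exists_weight_eq k X w (n + n)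
  -- One variable per random word of the run; by `hidx` the default 0 is never used in the counts.
  let x : ℕ → ℕ → MvPolynomial (Fin T) ℤ := fun a j =>
    if h : L a * k + j < T then MvPolynomial.X ⟨L a * k + j, h⟩ else 0
  have hx : ∀ a j, (x a j).totalDegree ≤ 1 := by
    intro a j
    dsimp only [x]
    split_ifs <;> simp
  have hidx : ∀ i < n + n, ∀ j < m, L (w i) * k + j < T := by
    intro i hi j hj
    have := Nat.mul_le_mul_right k (show L (w i) + 1 ≤ n + n from (hL i hi).1)
    rw [Nat.succ_mul] at this
    lia
  have heval : ∀ f : Fin T → ℤ, ∀ y : ℕ → ℕ → ℤ,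
      (∀ i < n + n, ∀ j, (hj : j < m) → ∀ h : L (w i) * k + j < T, f ⟨_, h⟩ = y (w i) j) →
      ∀ s, s ≤ n → MvPolynomial.eval f (weightedCount x (fun a => w (s + a)) n m) =
        weightedCount y (fun a => w (s + a)) n m := by
    intro f y hf s hs
    rw [map_weightedCount]
    refine weightedCount_congr (fun _ _ => rfl) fun a ha b hb => ?_
    dsimp only [x]
    rw [dif_pos (hidx _ (by lia) b hb), MvPolynomial.eval_X]
    exact hf _ (by lia) b hb _
  have hzero : (fun a => w (0 + a)) = w := by simp
  set p := weightedCount x w n m - weightedCount x (fun a => w (n + a)) n m with hpdef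
  have hp : p ≠ 0 := by
    intro hp0
    -- The indicator weights of v as a point of the variable space: index t belongs to place t % k
    -- of the letter at position t / k. There p takes the value binom w₁ v - binom w₂ v.
    have key := heval (fun t => if ∃ h : (t : ℕ) % k < m, (v ⟨(t : ℕ) % k, h⟩ : ℕ) = w (t / k)
      then 1 else 0) (fun a j => if ∃ h : j < m, (v ⟨j, h⟩ : ℕ) = a then 1 else 0) (by
        intro i hi j hj h
        have h1 : (L (w i) * k + j) % k = j := by
          rw [Nat.mul_add_mod_self_right, Nat.mod_eq_of_lt (by lia)]
        have h2 : (L (w i) * k + j) / k = L (w i) := by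
          rw [mul_comm, Nat.mul_add_div (by lia), Nat.div_eq_of_lt (by lia), add_zero]
        simp only [h1, h2, (hL i hi).2.1])
    have e₁ := key 0 (Nat.zero_le n)
    have e₂ := key n le_rfl
    rw [hzero, weightedCount_indicator w₁ w hw₁] at e₁
    rw [weightedCount_indicator w₂ (fun a => w (n + a)) hw₂] at e₂
    rw [sub_eq_zero.1 (hpdef.symm.trans hp0), e₂] at e₁
    exact hv (by exact_mod_cast e₁.symm)
  have hdeg : p.totalDegree ≤ m :=
    (MvPolynomial.totalDegree_sub _ _).trans (max_le (totalDegree_weightedCount_le hx _ _ _)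
      (totalDegree_weightedCount_le hx _ _ _))
  refine le_trans ?_ ((card_eval_mod_eq_zero_le hX hp).trans ?_)
  · refine Nat.cast_le.2 (card_le_card fun u hu => ?_)
    simp only [mem_filter, mem_univ, true_and] at hu ⊢
    have key := heval (fun i => (((u i : ℕ) % X : ℕ) : ℤ))
      (fun a j => ((weight (extend u) k X w (n + n) a j : ℕ) : ℤ)) (by
        intro i hi j hj h
        rw [(hL i hi).2.2 W (extend u) j]
        simp [extend, h])
    have e₁ := key 0 (Nat.zero_le n)
    have e₂ := key n le_rfl
    rw [hzero] at e₁
    have c := map_weightedCount (Nat.castRingHom ℤ) (weight (extend u) k X w (n + n))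
    simp only [eq_natCast] at c
    rw [hpdef, map_sub, e₁, e₂, ← c, ← c, hu, sub_self]
  · gcongr

theorem one_sub_le_probAnswer {σ n k W : ℕ} (w₁ w₂ : Fin n → Fin σ) (hkn : k ≤ n)
    (hW : 8 * Nat.clog 2 (n + σ + 2) ≤ W) (h : ¬ BinomEquiv k w₁ w₂) :
    1 - 1 / (n : ℝ) ≤ probAnswer binomTest W (start k w₁ w₂)
      (200 * (n * k ^ 2 + k ^ 4 + 1)) false := by
  classical
  obtain ⟨m, hmk, v, hv⟩ : ∃ m ≤ k, ∃ v : Fin m → Fin σ, binom w₁ v ≠ binom w₂ v := by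
    simpa [BinomEquiv] using h
  have hk : 0 < k := by
    rcases Nat.eq_zero_or_pos k with rfl | hk
    · exact absurd (binomEquiv_zero w₁ w₂) h
    · exact hk
  have hn : 0 < n := hk.trans_le hkn
  set T := 200 * (n * k ^ 2 + k ^ 4 + 1)
  set X := 2 ^ n.size * 2 ^ n.size with hXdef
  obtain ⟨w, hw⟩ : ∃ w, w = (start k w₁ w₂).mem := ⟨_, rfl⟩
  have hT : (n + n) * k ≤ T := by
    have : n * k ≤ n * k ^ 2 := Nat.mul_le_mul_left _ (Nat.le_self_pow (by norm_num) k)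
    rw [Nat.add_mul]
    lia
  have hXW : X ∣ 2 ^ W := by
    rw [hXdef, ← pow_add]
    refine pow_dvd_pow 2 ?_
    have : n.size ≤ Nat.clog 2 (n + σ + 2) := by
      refine Nat.size_le.2 (lt_of_lt_of_le ?_ (Nat.le_pow_clog (by norm_num) _))
      lia
    lia
  have hbad := card_weightedCount_eq_le (T := T) (k := k) (w := w)
    (fun a => hw ▸ start_mem_left w₁ w₂ a) (fun a => hw ▸ start_mem_right w₁ w₂ a) hXW hmk hT hv
  set A := Finset.univ.filter fun u : Fin T → Fin (2 ^ W) =>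
    answerWithin binomTest (extend u) (start k w₁ w₂) T = some false
  set Z := Finset.univ.filter fun u : Fin T → Fin (2 ^ W) =>
      weightedCount (weight (extend u) k X w (n + n)) w n m =
        weightedCount (weight (extend u) k X w (n + n)) (fun a => w (n + a)) n m
  have hcover : (Finset.univ : Finset (Fin T → Fin (2 ^ W))) ⊆ A ∪ Z := by
    intro u _
    by_cases hu : u ∈ Z
    · exact Finset.mem_union_right _ hu
    · refine Finset.mem_union_left _ (Finset.mem_filter.2 ⟨Finset.mem_univ _, ?_⟩)
      have hans := answerWithin_of_reach (reach_answer (extend u) w₁ w₂ hkn hW hw rfl)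
      rw [decide_eq_false] at hans
      · exact hans
      · intro hall
        exact hu (Finset.mem_filter.2 ⟨Finset.mem_univ _, hall m hmk⟩)
  have hcardN : Fintype.card (Fin T → Fin (2 ^ W)) ≤ A.card + Z.card :=
    (Finset.card_le_card hcover).trans (Finset.card_union_le _ _)
  have htot : (Fintype.card (Fin T → Fin (2 ^ W)) : ℝ) = (2 ^ W : ℝ) ^ T := by
    simp
  have hpos : (0 : ℝ) < (2 ^ W : ℝ) ^ T := by positivity
  have hcardR : (2 ^ W : ℝ) ^ T ≤ A.card + Z.card := by
    rw [← htot]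
    exact_mod_cast hcardN
  -- Here m ≤ n < 2^s and X is the square of 2^s.
  have hmX : (m : ℝ) / X ≤ 1 / n := by
    have hX0 : (0 : ℝ) < X := by positivity
    have hn0 : (0 : ℝ) < n := by exact_mod_cast hn
    rw [div_le_div_iff₀ hX0 hn0, one_mul]
    have hnB : n < 2 ^ n.size := Nat.lt_size_self n
    have : m * n ≤ X := Nat.mul_le_mul (by lia) hnB.le
    exact_mod_cast this
  rw [probAnswer, htot, le_div_iff₀ hpos]
  have := mul_le_mul_of_nonneg_right hmX hpos.le
  change _ ≤ (A.card : ℝ)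
  nlinarith

end WordRAM

/-! ### The theorem -/

theorem theorem2 :
    -- a Monte-Carlo program for the unit-cost RAM with words of `Ω(log n)` bits
    (∃ (P : WordRAM.Program) (c C : ℕ), 1 ≤ c ∧
      ∀ (σ n k W : ℕ) (w₁ w₂ : Fin n → Fin σ), k ≤ n → c * Nat.clog 2 (n + σ + 2) ≤ W →
        (∀ ω : ℕ → Fin (2 ^ W), ∃ r : Bool,
          WordRAM.answerWithin P ω (WordRAM.start k w₁ w₂)
            (C * (n * k ^ 2 + k ^ 4 + 1)) = some r) ∧
        (KBinomial.BinomEquiv k w₁ w₂ → ∀ ω : ℕ → Fin (2 ^ W),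
          WordRAM.answerWithin P ω (WordRAM.start k w₁ w₂)
            (C * (n * k ^ 2 + k ^ 4 + 1)) = some true) ∧
        (¬ KBinomial.BinomEquiv k w₁ w₂ →
          1 - 1 / (n : ℝ) ≤
            WordRAM.probAnswer P W (WordRAM.start k w₁ w₂)
              (C * (n * k ^ 2 + k ^ 4 + 1)) false)) ∧
    -- the fingerprint test for binary words
    (∀ (n k : ℕ) (w₁ w₂ : Fin n → Fin 2), k ≤ n →
      (KBinomial.BinomEquiv k w₁ w₂ →
        ∀ p ∈ KBinomial.bitPrimes (KBinomial.primeBits n k), ∀ x : ZMod p,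
          Polynomial.aeval x (KBinomial.Q k w₁) = Polynomial.aeval x (KBinomial.Q k w₂)) ∧
      (¬ KBinomial.BinomEquiv k w₁ w₂ →
        1 - 1 / (n : ℝ) ≤ KBinomial.fingerprintNoProb k w₁ w₂)) := by
  refine ⟨⟨WordRAM.binomTest, 8, 200, by norm_num, ?_⟩, ?_⟩
  · intro σ n k W w₁ w₂ hkn hW
    refine ⟨fun ω => ⟨_, WordRAM.answerWithin_of_reach
      (WordRAM.reach_answer ω w₁ w₂ hkn hW rfl rfl)⟩, fun h ω => ?_,
      WordRAM.one_sub_le_probAnswer w₁ w₂ hkn hW⟩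
    have hans := WordRAM.answerWithin_of_reach (WordRAM.reach_answer ω w₁ w₂ hkn hW rfl rfl)
    rw [decide_eq_true] at hans
    · exact hans
    · intro j hj
      rw [KBinomial.weightedCount_eq_sum_binom _ w₁ _ (WordRAM.start_mem_left w₁ w₂),
        KBinomial.weightedCount_eq_sum_binom _ w₂ _ (WordRAM.start_mem_right w₁ w₂)]
      exact Finset.sum_congr rfl fun v _ => by rw [h j hj v]
  · exact fun n k w₁ w₂ _ => ⟨fun h p _ x => by rw [KBinomial.Q_eq_of_binomEquiv h],
      KBinomial.le_fingerprintNoProb w₁ w₂⟩
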